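/- **Theorem.** Let $X$ be a compact Riemann surface, let $g$ be a smooth Riemannian metric in the conformal class of $X$, with area measure $d\mu$ and Gauss curvature $K(g)$, let $\beta$ be a smooth $(0,1)$-form on $X$ with values in $T^{1,0}X$, and let $\lambda, C\in\mathbb R$ with $\lambda<0$. For a smooth function $u:X\to\mathbb R$ and a smooth section $f$ of $T^{1,0}X$ put $$\mathcal D(u,f)=\int_X\Big[|\partial u|^2+K(g)\,u+e^{2u}\Big(-\frac{\lambda}{2}+|\beta+\bar\partial f|^2\Big)\Big]\,d\mu+C ,$$ where the pointwise norms are those of the Hermitian metric induced by $g$: if $g=\rho\,|dz|^2$ locally, then $|dz|^2=|d\bar z|^2=2/\rho$ and $|\partial/\partial z|^2=\rho/2$. (As $f$ varies, $\beta+\bar\partial f$ runs through the cohomology class $[\beta]$.) Let $(u,f)$ be a critical point of $\mathcal D$, i.e. the first variation of $\mathcal D$ at $(u,f)$ vanishes in every direction $(v,w)$, where $v$ is a smooth real function and $w$ a smooth section of $T^{1,0}X$. Then the Hessian (second variation) $H$ of $\mathcal D$ at $(u,f)$ exists as a symmetric real bilinear form on the space of such pairs $(v,w)$, and it is positive definite: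 $H\big((v,w),(v,w)\big)>0$ for every $(v,w)\neq(0,0)$. -/

import Mathlib

open scoped Manifold ContDiff ComplexConjugate
open MeasureTheory

namespace RiemannSurface

noncomputable section

/-! ### Wirtinger derivatives in the plane -/

/-- The Wirtinger derivative `∂F/∂z = (∂F/∂x - i ∂F/∂y) / 2`. -/
def wirtinger (F : ℂ → ℂ) (z : ℂ) : ℂ :=
  (fderiv ℝ F z 1 - Complex.I * fderiv ℝ F z Complex.I) / 2

/-- The Wirtinger derivative `∂F/∂z̄ = (∂F/∂x + i ∂F/∂y) / 2`. -/
def wirtingerBar (F : ℂ → ℂ) (z : ℂ) : ℂ :=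
  (fderiv ℝ F z 1 + Complex.I * fderiv ℝ F z Complex.I) / 2

theorem wirtinger_comp {F τ : ℂ → ℂ} {z : ℂ} (hF : DifferentiableAt ℝ F (τ z))
    (hτ : DifferentiableAt ℂ τ z) :
    wirtinger (fun w => F (τ w)) z = wirtinger F (τ z) * deriv τ z := by
  have h2 : HasFDerivAt τ (deriv τ z • (1 : ℂ →L[ℝ] ℂ)) z := hτ.hasDerivAt.complexToReal_fderiv
  have h3 := (hF.hasFDerivAt.comp z h2).fderiv
  have h4 : (fun w => F (τ w)) = F ∘ τ := rfl
  have key : ∀ c : ℂ, fderiv ℝ F (τ z) c =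
      c.re * fderiv ℝ F (τ z) 1 + c.im * fderiv ℝ F (τ z) Complex.I := by
    intro c
    have : c = c.re • (1 : ℂ) + c.im • Complex.I := by simp
    conv_lhs => rw [this]
    rw [map_add, map_smul, map_smul]; simp
  unfold wirtinger
  rw [h4, h3]
  simp only [ContinuousLinearMap.comp_apply, smul_apply,
    one_apply_eq_self, smul_eq_mul, mul_one]
  rw [key (deriv τ z), key (deriv τ z * Complex.I)]
  conv_rhs => rw [← Complex.re_add_im (deriv τ z)]
  simp only [Complex.mul_re, Complex.mul_im, Complex.I_re, Complex.I_im]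
  push_cast
  linear_combination ((deriv τ z).im * fderiv ℝ F (τ z) Complex.I / 2) * Complex.I_sq

theorem wirtingerBar_comp {F τ : ℂ → ℂ} {z : ℂ} (hF : DifferentiableAt ℝ F (τ z))
    (hτ : DifferentiableAt ℂ τ z) :
    wirtingerBar (fun w => F (τ w)) z = wirtingerBar F (τ z) * conj (deriv τ z) := by
  have h2 : HasFDerivAt τ (deriv τ z • (1 : ℂ →L[ℝ] ℂ)) z := hτ.hasDerivAt.complexToReal_fderiv
  have h3 := (hF.hasFDerivAt.comp z h2).fderiv
  have h4 : (fun w => F (τ w)) = F ∘ τ := rfl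
  have key : ∀ c : ℂ, fderiv ℝ F (τ z) c =
      c.re * fderiv ℝ F (τ z) 1 + c.im * fderiv ℝ F (τ z) Complex.I := by
    intro c
    have : c = c.re • (1 : ℂ) + c.im • Complex.I := by simp
    conv_lhs => rw [this]
    rw [map_add, map_smul, map_smul]; simp
  unfold wirtingerBar
  rw [h4, h3]
  simp only [ContinuousLinearMap.comp_apply, smul_apply,
    one_apply_eq_self, smul_eq_mul, mul_one]
  rw [key (deriv τ z), key (deriv τ z * Complex.I)]
  have hc : conj (deriv τ z) = (deriv τ z).re - (deriv τ z).im * Complex.I := by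
    apply Complex.ext <;> simp
  rw [hc]
  simp only [Complex.mul_re, Complex.mul_im, Complex.I_re, Complex.I_im]
  push_cast
  linear_combination ((deriv τ z).im * fderiv ℝ F (τ z) Complex.I / 2) * Complex.I_sq

theorem wirtingerBar_mul_of_holomorphic {F h : ℂ → ℂ} {z : ℂ} (hF : DifferentiableAt ℝ F z)
    (hh : DifferentiableAt ℂ h z) :
    wirtingerBar (fun w => F w * h w) z = wirtingerBar F z * h z := by
  have h2 : HasFDerivAt h (deriv h z • (1 : ℂ →L[ℝ] ℂ)) z := hh.hasDerivAt.complexToReal_fderiv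
  have h3 := (hF.hasFDerivAt.mul h2).fderiv
  have h4 : (fun w => F w * h w) = F * h := rfl
  unfold wirtingerBar
  rw [h4, h3]
  simp only [add_apply, smul_apply,
    one_apply_eq_self, smul_eq_mul, mul_one]
  linear_combination (F z * deriv h z / 2) * Complex.I_sq

theorem contDiffOn_wirtinger {F : ℂ → ℂ} {s : Set ℂ} (hs : IsOpen s) (hF : ContDiffOn ℝ ∞ F s) :
    ContDiffOn ℝ ∞ (wirtinger F) s := by
  have h := hF.fderiv_of_isOpen (m := ∞) hs (by simp)
  have h1 := h.clm_apply (contDiffOn_const (c := (1 : ℂ)))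
  have h2 := h.clm_apply (contDiffOn_const (c := Complex.I))
  exact (h1.sub (contDiffOn_const.mul h2)).div_const 2

theorem contDiffOn_wirtingerBar {F : ℂ → ℂ} {s : Set ℂ} (hs : IsOpen s)
    (hF : ContDiffOn ℝ ∞ F s) : ContDiffOn ℝ ∞ (wirtingerBar F) s := by
  have h := hF.fderiv_of_isOpen (m := ∞) hs (by simp)
  have h1 := h.clm_apply (contDiffOn_const (c := (1 : ℂ)))
  have h2 := h.clm_apply (contDiffOn_const (c := Complex.I))
  exact (h1.add (contDiffOn_const.mul h2)).div_const 2

/-! ### Charts of a Riemann surface -/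

section Charts

variable {X : Type*} [TopologicalSpace X] [ChartedSpace ℂ X]

/-- The preferred chart at `x`, as an element of the atlas. -/
def chartIn (x : X) : atlas ℂ X := ⟨chartAt ℂ x, chart_mem_atlas ℂ x⟩

/-- The coordinate change from the chart `e` to the chart `e'`, defined on
`(e.symm.trans e').source`. -/
def transition (e e' : atlas ℂ X) (z : ℂ) : ℂ := e'.1 (e.1.symm z)

/-- The part of the image of the chart `e` that corresponds to the overlap of `e` and `e'`. -/
def overlap (e e' : atlas ℂ X) : Set ℂ := (e.1.symm.trans e'.1).source

theorem isOpen_overlap (e e' : atlas ℂ X) : IsOpen (overlap e e') :=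
  (e.1.symm.trans e'.1).open_source

theorem mem_overlap {e e' : atlas ℂ X} {z : ℂ} :
    z ∈ overlap e e' ↔ z ∈ e.1.target ∧ e.1.symm z ∈ e'.1.source := by
  simp [overlap]

theorem transition_mem_target {e e' : atlas ℂ X} {z : ℂ} (hz : z ∈ overlap e e') :
    transition e e' z ∈ e'.1.target :=
  e'.1.map_source (mem_overlap.1 hz).2

theorem transition_mem_overlap {e e' : atlas ℂ X} {z : ℂ} (hz : z ∈ overlap e e') :
    transition e e' z ∈ overlap e' e := by
  have h := mem_overlap.1 hz
  refine mem_overlap.2 ⟨transition_mem_target hz, ?_⟩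
  rw [transition, e'.1.left_inv h.2]
  exact e.1.map_target h.1

theorem transition_transition {e e' : atlas ℂ X} {z : ℂ} (hz : z ∈ overlap e e') :
    transition e' e (transition e e' z) = z := by
  have h := mem_overlap.1 hz
  rw [transition, transition, e'.1.left_inv h.2, e.1.right_inv h.1]

variable [IsManifold 𝓘(ℂ) ω X]

theorem differentiableOn_transition (e e' : atlas ℂ X) :
    DifferentiableOn ℂ (transition e e') (overlap e e') := by
  have h := HasGroupoid.compatible (G := contDiffGroupoid ω 𝓘(ℂ)) e.2 e'.2
  rw [contDiffGroupoid, mem_groupoid_of_pregroupoid] at h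
  have h1 := h.1
  simp only [contDiffPregroupoid, modelWithCornersSelf_coe, modelWithCornersSelf_coe_symm,
    Function.comp_id, Function.id_comp, Set.range_id, Set.inter_univ, Set.preimage_id] at h1
  exact ContDiffOn.differentiableOn h1 (by simp)

theorem differentiableAt_transition {e e' : atlas ℂ X} {z : ℂ} (hz : z ∈ overlap e e') :
    DifferentiableAt ℂ (transition e e') z :=
  (differentiableOn_transition e e').differentiableAt ((isOpen_overlap e e').mem_nhds hz)

theorem deriv_transition_ne_zero {e e' : atlas ℂ X} {z : ℂ} (hz : z ∈ overlap e e') :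
    deriv (transition e e') z ≠ 0 := by
  have h1 := (differentiableAt_transition hz).hasDerivAt
  have h2 := (differentiableAt_transition (transition_mem_overlap hz)).hasDerivAt
  have h3 := h2.comp z h1
  have h4 : (transition e' e ∘ transition e e') =ᶠ[nhds z] id := by
    filter_upwards [(isOpen_overlap e e').mem_nhds hz] with w hw
    exact transition_transition hw
  have h5 := (h3.congr_of_eventuallyEq h4.symm).unique (hasDerivAt_id z)
  intro h0
  rw [h0, mul_zero] at h5
  exact zero_ne_one h5

end Charts

/-- A Riemann surface is a smooth real manifold. -/
theorem isManifold_real (X : Type*) [TopologicalSpace X] [ChartedSpace ℂ X]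
    [IsManifold 𝓘(ℂ) ω X] : IsManifold 𝓘(ℝ, ℂ) ∞ X := by
  apply isManifold_of_contDiffOn
  intro e e' he he'
  have h := differentiableOn_transition (⟨e, he⟩ : atlas ℂ X) ⟨e', he'⟩
  have h' : ContDiffOn ℂ ∞ _ _ := h.contDiffOn (isOpen_overlap _ _)
  have h2 := h'.restrict_scalars ℝ
  have h3 : (fun x => e' (e.symm x)) = transition (⟨e, he⟩ : atlas ℂ X) ⟨e', he'⟩ := rfl
  simpa [overlap, Function.comp_def, h3] using h2

/-! ### Smooth tensors on a Riemann surface -/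

section Tensors

variable (X : Type*) [TopologicalSpace X] [ChartedSpace ℂ X]

/-- The space of smooth (`C^∞`) tensors of type `(p, q)`, written locally as
`φ(z) (dz)^p ⊗ (dz̄)^q`, i.e. the smooth sections of the line bundle `K^p ⊗ K̄^q`, where `K` is the
holomorphic cotangent bundle; negative powers of `dz` are powers of `∂/∂z`. In particular:
* type `(-1, 0)`: smooth sections `φ(z) ∂/∂z` of `T^{1,0}X`;
* type `(-1, 1)`: smooth `(0,1)`-forms `φ(z) dz̄ ⊗ ∂/∂z` with values in `T^{1,0}X`;
* type `(1, 0)`: smooth `(1,0)`-forms `φ(z) dz`.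

A tensor is given by its coefficient in every chart, as a function on the image of the chart
(extended by `0` to `ℂ`); the coefficients are smooth and obey the transformation law. -/
def SmoothTensor (p q : ℤ) : Submodule ℂ (atlas ℂ X → ℂ → ℂ) where
  carrier := {φ |
    (∀ e : atlas ℂ X, ContDiffOn ℝ ∞ (φ e) e.1.target) ∧
    (∀ e : atlas ℂ X, ∀ z, z ∉ e.1.target → φ e z = 0) ∧
    (∀ e e' : atlas ℂ X, ∀ z ∈ overlap e e',
      φ e z = φ e' (transition e e' z) *
        (deriv (transition e e') z ^ p * conj (deriv (transition e e') z) ^ q))}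
  add_mem' := by
    rintro φ ψ ⟨h1, h2, h3⟩ ⟨k1, k2, k3⟩
    refine ⟨fun e => (h1 e).add (k1 e), fun e z hz => ?_, fun e e' z hz => ?_⟩
    · simp [h2 e z hz, k2 e z hz]
    · simp only [Pi.add_apply]
      rw [h3 e e' z hz, k3 e e' z hz]; ring
  zero_mem' := by
    refine ⟨fun e => contDiffOn_const, fun e z hz => rfl, fun e e' z hz => ?_⟩
    simp
  smul_mem' := by
    rintro c φ ⟨h1, h2, h3⟩
    refine ⟨fun e => (h1 e).const_smul c, fun e z hz => ?_, fun e e' z hz => ?_⟩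
    · simp [h2 e z hz]
    · simp only [Pi.smul_apply, smul_eq_mul]
      rw [h3 e e' z hz]; ring

/-- Smooth sections of `T^{1,0}X`. -/
abbrev VectorField : Type _ := SmoothTensor X (-1) 0

/-- Smooth `(0,1)`-forms with values in `T^{1,0}X`. -/
abbrev BeltramiForm : Type _ := SmoothTensor X (-1) 1

/-- Smooth real functions on `X`. -/
abbrev SmoothFun : Type _ := C^∞⟮𝓘(ℝ, ℂ), X; 𝓘(ℝ, ℝ), ℝ⟯

variable {X} [IsManifold 𝓘(ℂ) ω X]

/-- The operator `∂̄`: on tensors of type `(p, 0)`, i.e. on sections of the holomorphic line bundle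
`K^p`, it is `∂̄(φ (dz)^p) = (∂φ/∂z̄) dz̄ ⊗ (dz)^p`. -/
def delbar {p : ℤ} (φ : SmoothTensor X p 0) : SmoothTensor X p 1 :=
  ⟨fun e => e.1.target.indicator (wirtingerBar (φ.1 e)), by
    obtain ⟨h1, h2, h3⟩ := φ.2
    refine ⟨fun e => ?_, fun e z hz => Set.indicator_of_notMem hz _, fun e e' z hz => ?_⟩
    · refine (contDiffOn_wirtingerBar e.1.open_target (h1 e)).congr fun z hz => ?_
      exact Set.indicator_of_mem hz _
    · beta_reduce
      rw [Set.indicator_of_mem (mem_overlap.1 hz).1,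
        Set.indicator_of_mem (transition_mem_target hz)]
      have hd := differentiableAt_transition hz
      have hev : φ.1 e =ᶠ[nhds z] fun w => φ.1 e' (transition e e' w) * deriv (transition e e') w ^ p :=
        by filter_upwards [(isOpen_overlap e e').mem_nhds hz] with w hw
           rw [h3 e e' w hw]; simp
      have hF : DifferentiableAt ℝ (φ.1 e') (transition e e' z) :=
        ((h1 e').differentiableOn (by simp)).differentiableAt
          (e'.1.open_target.mem_nhds (transition_mem_target hz))
      have hh : DifferentiableAt ℂ (fun w => deriv (transition e e') w ^ p) z := by
        refine DifferentiableAt.zpow ?_ (Or.inl (deriv_transition_ne_zero hz))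
        exact ((differentiableOn_transition e e').deriv (isOpen_overlap e e')).differentiableAt
          ((isOpen_overlap e e').mem_nhds hz)
      have hw : wirtingerBar (φ.1 e) z = wirtingerBar
          (fun w => φ.1 e' (transition e e' w) * deriv (transition e e') w ^ p) z := by
        unfold wirtingerBar; rw [hev.fderiv_eq]
      have hm : wirtingerBar
          (fun w => φ.1 e' (transition e e' w) * deriv (transition e e') w ^ p) z =
          wirtingerBar (fun w => φ.1 e' (transition e e' w)) z * deriv (transition e e') z ^ p :=
        wirtingerBar_mul_of_holomorphic (hF.comp z hd.real_of_complex) hh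
      rw [hw, hm, wirtingerBar_comp hF hd, zpow_one]
      ring⟩

/-- A smooth function in a chart is smooth. -/
theorem contDiffOn_chart (u : SmoothFun X) (e : atlas ℂ X) :
    ContDiffOn ℝ ∞ (fun z => u (e.1.symm z)) e.1.target := by
  have := isManifold_real X
  have h := contMDiffOn_symm_of_mem_maximalAtlas (I := 𝓘(ℝ, ℂ)) (n := ∞)
    (IsManifold.subset_maximalAtlas e.2)
  have h2 := u.contMDiff.comp_contMDiffOn h
  exact contMDiffOn_iff_contDiffOn.1 h2

/-- The `(1,0)`-form `∂u = (∂u/∂z) dz` of a smooth real function `u`. -/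
def del (u : SmoothFun X) : SmoothTensor X 1 0 :=
  ⟨fun e => e.1.target.indicator (wirtinger (fun z => (u (e.1.symm z) : ℂ))), by
    have hs : ∀ e : atlas ℂ X, ContDiffOn ℝ ∞ (fun z => (u (e.1.symm z) : ℂ)) e.1.target :=
      fun e => Complex.ofRealCLM.contDiff.comp_contDiffOn (contDiffOn_chart u e)
    refine ⟨fun e => ?_, fun e z hz => Set.indicator_of_notMem hz _, fun e e' z hz => ?_⟩
    · refine (contDiffOn_wirtinger e.1.open_target (hs e)).congr fun z hz => ?_
      exact Set.indicator_of_mem hz _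
    · beta_reduce
      rw [Set.indicator_of_mem (mem_overlap.1 hz).1,
        Set.indicator_of_mem (transition_mem_target hz)]
      have hd := differentiableAt_transition hz
      have hev : (fun w => (u (e.1.symm w) : ℂ)) =ᶠ[nhds z]
          fun w => (fun y => (u (e'.1.symm y) : ℂ)) (transition e e' w) := by
        filter_upwards [(isOpen_overlap e e').mem_nhds hz] with w hw
        simp only [transition]
        rw [e'.1.left_inv (mem_overlap.1 hw).2]
      have hF : DifferentiableAt ℝ (fun y => (u (e'.1.symm y) : ℂ)) (transition e e' z) :=
        ((hs e').differentiableOn (by simp)).differentiableAt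
          (e'.1.open_target.mem_nhds (transition_mem_target hz))
      have hw : wirtinger (fun w => (u (e.1.symm w) : ℂ)) z =
          wirtinger (fun w => (fun y => (u (e'.1.symm y) : ℂ)) (transition e e' w)) z := by
        unfold wirtinger; rw [hev.fderiv_eq]
      rw [hw, wirtinger_comp hF hd]
      simp⟩

end Tensors

/-! ### Conformal metrics -/

section Metrics

variable (X : Type*) [TopologicalSpace X] [ChartedSpace ℂ X]

/-- A smooth Riemannian metric in the conformal class determined by the complex structure: in the
chart `e` with coordinate `z = x + i y` it is `g = ρ_e(z) |dz|² = ρ_e(z) (dx² + dy²)`. -/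
structure ConformalMetric where
  /-- The conformal factor in each chart (only its values on the image of the chart matter). -/
  density : atlas ℂ X → ℂ → ℝ
  smooth : ∀ e : atlas ℂ X, ContDiffOn ℝ ∞ (density e) e.1.target
  pos : ∀ e : atlas ℂ X, ∀ z ∈ e.1.target, 0 < density e z
  transform : ∀ e e' : atlas ℂ X, ∀ z ∈ overlap e e',
    density e z = density e' (transition e e' z) * ‖deriv (transition e e') z‖ ^ 2

variable {X}

namespace ConformalMetric

variable (g : ConformalMetric X)

/-- The Riemannian area measure `dμ` of `g`. In the chart `e` it is `ρ_e dx dy`, carried to the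
surface by `e⁻¹`; these measures on the chart domains agree on overlaps, and the area measure, their
common extension, is their supremum. -/
def area [MeasurableSpace X] : Measure X :=
  ⨆ e : atlas ℂ X, Measure.map e.1.symm
    ((volume.restrict e.1.target).withDensity fun z => ENNReal.ofReal (g.density e z))

/-- The Gauss curvature `K = -(1/2ρ) Δ log ρ`, computed in a chart at `x`. -/
def gaussCurvature (x : X) : ℝ :=
  -Laplacian.laplacian (fun z => Real.log (g.density (chartIn x) z)) (chartAt ℂ x x) /
    (2 * g.density (chartIn x) (chartAt ℂ x x))

/-- The pointwise squared norm `|φ|²` of a tensor of type `(p, q)` with respect to the Hermitian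
metric induced by `g`, for which `|dz|² = |dz̄|² = 2/ρ` and `|∂/∂z|² = ρ/2`; computed in a chart
at `x`. -/
def normSq {p q : ℤ} (φ : SmoothTensor X p q) (x : X) : ℝ :=
  (2 / g.density (chartIn x) (chartAt ℂ x x)) ^ (p + q) * ‖φ.1 (chartIn x) (chartAt ℂ x x)‖ ^ 2

end ConformalMetric

end Metrics

/-! ### The functional and its second variation -/

section Functional

variable {X : Type*} [TopologicalSpace X] [ChartedSpace ℂ X] [IsManifold 𝓘(ℂ) ω X]
  [MeasurableSpace X]

/-- The functional
`𝒟(u, f) = ∫ (|∂u|² + K(g) u + e^{2u} (-λ/2 + |β + ∂̄f|²)) dμ + C`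
on pairs `(u, f)` of a smooth real function and a smooth section of `T^{1,0}X`. -/
def donaldson (g : ConformalMetric X) (β : BeltramiForm X) (lam C : ℝ)
    (P : SmoothFun X × VectorField X) : ℝ :=
  (∫ x, (g.normSq (del P.1) x + g.gaussCurvature x * P.1 x +
    Real.exp (2 * P.1 x) * (-lam / 2 + g.normSq (β + delbar P.2) x)) ∂g.area) + C

end Functional

end

end RiemannSurface

section Variations

variable {V : Type*} [AddCommGroup V] [Module ℝ V]

/-- `P` is a critical point of `D : V → ℝ`: the first variation of `D` at `P` exists and vanishes in
every direction. -/
def IsCriticalPoint (D : V → ℝ) (P : V) : Prop :=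
  ∀ ξ : V, HasDerivAt (fun t : ℝ => D (P + t • ξ)) 0 0

/-- `H` is the Hessian (second variation) of `D : V → ℝ` at `P`: all first variations
`δD(Q; η) = d/dt D(Q + t η)` at `t = 0` exist, and `H` is the symmetric bilinear form with
`H(ξ, η) = d/ds δD(P + s ξ; η)` at `s = 0`. -/
structure IsHessianAt (D : V → ℝ) (P : V) (H : LinearMap.BilinForm ℝ V) : Prop where
  differentiable : ∀ Q η : V, DifferentiableAt ℝ (fun t : ℝ => D (Q + t • η)) 0
  hasDerivAt : ∀ ξ η : V,
    HasDerivAt (fun s : ℝ => deriv (fun t : ℝ => D (P + s • ξ + t • η)) 0) (H ξ η) 0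
  symm : H.IsSymm

end Variations

namespace RiemannSurface

noncomputable section

/-! ### Wirtinger calculus -/

section Wirtinger

variable {F G : ℂ → ℂ} {z : ℂ}

/-! Write B = β + ∂̄f and E = e^{2u}, with ⟨·,·⟩ the real part of the Hermitian product.
Differentiating twice under the integral over the compact surface gives, for ξ = (v, w), H(ξ, ξ) = ∫
2|∂v|² + E (4v²(-λ/2 + |B|²) + 8v⟨B, ∂̄w⟩ + 2|∂̄w|²) dμ. This integrand may be negative at points,
because the cross term is too large to be absorbed by completing the square. Criticality is used in
two test directions to repair this.

Direction (0, v w): ∫ E⟨B, ∂̄(v w)⟩ = 0, so by the Leibniz rule half of the cross term can be traded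
for -4E⟨B, ∂̄v ⊗ w⟩. The square E|∂̄w + 2vB|² then splits off, and the traded term is absorbed by
2|∂v|² at the price of 2E²|w|²|B|² (`pairing_tmul_le`).

Direction (h, 0) with h = E|w|²: the u-equation tested against h replaces that loss, -2Eh|B|², by
2⟨∂u, ∂h⟩ + Kh - λEh.

What remains is ∫ E|∂̄w|² + 2⟨∂u, ∂h⟩ + Kh, plus -λ∫ E(2v² + h). The first integral is nonnegative
by the Bochner identity for the metric e^{2u}g: it is the L² norm squared of the (1,0) part of the
Chern covariant derivative of w (`bochner_plane`, `bochner_integral`). The second is strictly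
positive for (v, w) ≠ 0 because λ < 0.

The pointwise part of this is `hessianDensity_ge`, and `hessian_pos` integrates it. The other
ingredients are the chart independence of the integrands, the local description of the area measure,
the divergence theorem, and differentiation under the integral. -/

theorem wirtingerBar_congr (h : F =ᶠ[nhds z] G) : wirtingerBar F z = wirtingerBar G z := by
  unfold wirtingerBar; rw [h.fderiv_eq]

theorem wirtinger_congr (h : F =ᶠ[nhds z] G) : wirtinger F z = wirtinger G z := by
  unfold wirtinger; rw [h.fderiv_eq]

theorem wirtingerBar_add (hF : DifferentiableAt ℝ F z) (hG : DifferentiableAt ℝ G z) :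
    wirtingerBar (fun w => F w + G w) z = wirtingerBar F z + wirtingerBar G z := by
  unfold wirtingerBar
  rw [fderiv_fun_add hF hG]
  simp only [add_apply]; ring

theorem wirtingerBar_sub (hF : DifferentiableAt ℝ F z) (hG : DifferentiableAt ℝ G z) :
    wirtingerBar (fun w => F w - G w) z = wirtingerBar F z - wirtingerBar G z := by
  unfold wirtingerBar
  rw [fderiv_fun_sub hF hG]
  simp only [sub_apply]; ring

theorem wirtingerBar_const_mul (c : ℂ) (hF : DifferentiableAt ℝ F z) :
    wirtingerBar (fun w => c * F w) z = c * wirtingerBar F z := by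
  unfold wirtingerBar
  rw [fderiv_const_mul hF]
  simp only [smul_apply, smul_eq_mul]; ring

theorem wirtinger_add (hF : DifferentiableAt ℝ F z) (hG : DifferentiableAt ℝ G z) :
    wirtinger (fun w => F w + G w) z = wirtinger F z + wirtinger G z := by
  unfold wirtinger
  rw [fderiv_fun_add hF hG]
  simp only [add_apply]; ring

theorem wirtinger_const_mul (c : ℂ) (hF : DifferentiableAt ℝ F z) :
    wirtinger (fun w => c * F w) z = c * wirtinger F z := by
  unfold wirtinger
  rw [fderiv_const_mul hF]
  simp only [smul_apply, smul_eq_mul]; ring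

theorem wirtingerBar_mul (hF : DifferentiableAt ℝ F z) (hG : DifferentiableAt ℝ G z) :
    wirtingerBar (fun w => F w * G w) z = wirtingerBar F z * G z + F z * wirtingerBar G z := by
  unfold wirtingerBar
  rw [fderiv_fun_mul hF hG]
  simp only [add_apply, smul_apply, smul_eq_mul]; ring

theorem wirtinger_mul (hF : DifferentiableAt ℝ F z) (hG : DifferentiableAt ℝ G z) :
    wirtinger (fun w => F w * G w) z = wirtinger F z * G z + F z * wirtinger G z := by
  unfold wirtinger
  rw [fderiv_fun_mul hF hG]
  simp only [add_apply, smul_apply, smul_eq_mul]; ring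

theorem fderiv_conj_apply (F : ℂ → ℂ) (z v : ℂ) :
    fderiv ℝ (fun w => conj (F w)) z v = conj (fderiv ℝ F z v) := by
  have := Complex.conjCLE.comp_fderiv (f := F) (x := z)
  have h : (Complex.conjCLE ∘ F) = fun w => conj (F w) := rfl
  rw [h] at this
  rw [this]; rfl

theorem wirtingerBar_conj (F : ℂ → ℂ) (z : ℂ) :
    wirtingerBar (fun w => conj (F w)) z = conj (wirtinger F z) := by
  unfold wirtingerBar wirtinger
  rw [fderiv_conj_apply, fderiv_conj_apply]
  simp [Complex.conj_I, Complex.conj_ofNat]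

theorem wirtinger_conj (F : ℂ → ℂ) (z : ℂ) :
    wirtinger (fun w => conj (F w)) z = conj (wirtingerBar F z) := by
  unfold wirtingerBar wirtinger
  rw [fderiv_conj_apply, fderiv_conj_apply]
  simp [Complex.conj_I, Complex.conj_ofNat, sub_eq_add_neg]

theorem wirtingerBar_cexp (hF : DifferentiableAt ℝ F z) :
    wirtingerBar (fun w => Complex.exp (F w)) z = Complex.exp (F z) * wirtingerBar F z := by
  unfold wirtingerBar
  rw [hF.hasFDerivAt.cexp.fderiv]
  simp only [smul_apply, smul_eq_mul]; ring

theorem wirtinger_cexp (hF : DifferentiableAt ℝ F z) :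
    wirtinger (fun w => Complex.exp (F w)) z = Complex.exp (F z) * wirtinger F z := by
  unfold wirtinger
  rw [hF.hasFDerivAt.cexp.fderiv]
  simp only [smul_apply, smul_eq_mul]; ring

theorem wirtingerBar_ofReal (f : ℂ → ℝ) (z : ℂ) :
    wirtingerBar (fun w => (f w : ℂ)) z = conj (wirtinger (fun w => (f w : ℂ)) z) := by
  rw [← wirtingerBar_conj]; simp

theorem differentiableAt_fderiv_of_contDiffAt (hF : ContDiffAt ℝ 2 F z) :
    DifferentiableAt ℝ (fderiv ℝ F) z :=
  (hF.fderiv_right (m := 1) (by norm_num)).differentiableAt (by norm_num)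

theorem fderiv_wirtinger_apply (hF : ContDiffAt ℝ 2 F z) (v : ℂ) :
    fderiv ℝ (wirtinger F) z v =
      (fderiv ℝ (fderiv ℝ F) z v 1 - Complex.I * fderiv ℝ (fderiv ℝ F) z v Complex.I) / 2 := by
  have h := (differentiableAt_fderiv_of_contDiffAt hF).hasFDerivAt
  have h1 := h.clm_apply (hasFDerivAt_const (1 : ℂ) z)
  have hI := h.clm_apply (hasFDerivAt_const Complex.I z)
  have := ((h1.sub (hI.const_mul Complex.I)).mul_const (2⁻¹ : ℂ))
  have e : wirtinger F = fun w =>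
      (fderiv ℝ F w 1 - Complex.I * fderiv ℝ F w Complex.I) * 2⁻¹ := by
    funext w; rw [wirtinger, div_eq_mul_inv]
  rw [e]
  refine (congrArg (fun A : ℂ →L[ℝ] ℂ => A v) this.fderiv).trans ?_
  simp [div_eq_mul_inv]
  ring

theorem fderiv_wirtingerBar_apply (hF : ContDiffAt ℝ 2 F z) (v : ℂ) :
    fderiv ℝ (wirtingerBar F) z v =
      (fderiv ℝ (fderiv ℝ F) z v 1 + Complex.I * fderiv ℝ (fderiv ℝ F) z v Complex.I) / 2 := by
  have h := (differentiableAt_fderiv_of_contDiffAt hF).hasFDerivAt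
  have h1 := h.clm_apply (hasFDerivAt_const (1 : ℂ) z)
  have hI := h.clm_apply (hasFDerivAt_const Complex.I z)
  have := ((h1.add (hI.const_mul Complex.I)).mul_const (2⁻¹ : ℂ))
  have e : wirtingerBar F = fun w =>
      (fderiv ℝ F w 1 + Complex.I * fderiv ℝ F w Complex.I) * 2⁻¹ := by
    funext w; rw [wirtingerBar, div_eq_mul_inv]
  rw [e]
  refine (congrArg (fun A : ℂ →L[ℝ] ℂ => A v) this.fderiv).trans ?_
  simp [div_eq_mul_inv]
  ring

/-- The Wirtinger derivatives commute. -/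
theorem wirtinger_wirtingerBar (hF : ContDiffAt ℝ 2 F z) :
    wirtinger (wirtingerBar F) z = wirtingerBar (wirtinger F) z := by
  have hs : IsSymmSndFDerivAt ℝ F z := hF.isSymmSndFDerivAt (by simp)
  have h := hs.eq 1 Complex.I
  rw [wirtinger, wirtingerBar, fderiv_wirtinger_apply hF, fderiv_wirtinger_apply hF,
    fderiv_wirtingerBar_apply hF, fderiv_wirtingerBar_apply hF, h]
  ring

/-- The Laplacian is `4 ∂²/∂z̄∂z`. -/
theorem laplacian_eq_wirtinger {f : ℂ → ℝ} (hf : ContDiffAt ℝ 2 f z) :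
    (Laplacian.laplacian f z : ℂ) = 4 * wirtingerBar (wirtinger (fun w => (f w : ℂ))) z := by
  have hF : ContDiffAt ℝ 2 (fun w => (f w : ℂ)) z := Complex.ofRealCLM.contDiff.contDiffAt.comp z hf
  have hl := hf.laplacian_CLM_comp_left (l := Complex.ofRealCLM)
  have hl' : Laplacian.laplacian (fun w => (f w : ℂ)) z = (Laplacian.laplacian f z : ℂ) := hl
  have hs : IsSymmSndFDerivAt ℝ (fun w => (f w : ℂ)) z := hF.isSymmSndFDerivAt (by simp)
  have h := hs.eq 1 Complex.I
  rw [← hl', InnerProductSpace.laplacian_eq_iteratedFDeriv_complexPlane, wirtingerBar,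
    fderiv_wirtinger_apply hF, fderiv_wirtinger_apply hF, h]
  simp only [iteratedFDeriv_two_apply, Matrix.cons_val_zero, Matrix.cons_val_one]
  linear_combination (fderiv ℝ (fderiv ℝ fun w => (f w : ℂ)) z Complex.I Complex.I) * Complex.I_sq

theorem contDiffAt_wirtinger (hF : ContDiffAt ℝ ∞ F z) : ContDiffAt ℝ ∞ (wirtinger F) z := by
  have h := hF.fderiv_right (m := ∞) (by simp)
  exact ((h.clm_apply contDiffAt_const).sub
    (contDiffAt_const.mul (h.clm_apply contDiffAt_const))).div_const 2

theorem contDiffAt_wirtingerBar (hF : ContDiffAt ℝ ∞ F z) :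
    ContDiffAt ℝ ∞ (wirtingerBar F) z := by
  have h := hF.fderiv_right (m := ∞) (by simp)
  exact ((h.clm_apply contDiffAt_const).add
    (contDiffAt_const.mul (h.clm_apply contDiffAt_const))).div_const 2

/-- The Laplacian of a composition with a holomorphic function. -/
theorem laplacian_comp_holomorphic {f : ℂ → ℝ} {τ : ℂ → ℂ} {s : Set ℂ} (hs : IsOpen s)
    (hz : z ∈ s) (hτ : DifferentiableOn ℂ τ s) (hf : ContDiffAt ℝ ∞ f (τ z)) :
    Laplacian.laplacian (fun w => f (τ w)) z =
      Laplacian.laplacian f (τ z) * ‖deriv τ z‖ ^ 2 := by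
  have hτz : DifferentiableAt ℂ τ z := hτ.differentiableAt (hs.mem_nhds hz)
  have hτc : ContDiffAt ℝ ∞ τ z :=
    (((hτ.contDiffOn hs : ContDiffOn ℂ ∞ τ s).contDiffAt (hs.mem_nhds hz))).restrict_scalars ℝ
  have hF : ContDiffAt ℝ ∞ (fun w => (f w : ℂ)) (τ z) :=
    Complex.ofRealCLM.contDiff.contDiffAt.comp _ hf
  have hev : ∀ᶠ w in nhds z, ContDiffAt ℝ 1 (fun w => (f w : ℂ)) (τ w) :=
    hτz.continuousAt.eventually ((hF.of_le (by simp)).eventually (by simp))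
  have h1 : wirtinger (fun w => (f (τ w) : ℂ)) =ᶠ[nhds z]
      fun w => wirtinger (fun y => (f y : ℂ)) (τ w) * deriv τ w := by
    filter_upwards [hev, hs.mem_nhds hz] with w hw hws
    exact wirtinger_comp (hw.differentiableAt (by simp)) (hτ.differentiableAt (hs.mem_nhds hws))
  have hd : DifferentiableAt ℝ (wirtinger fun y => (f y : ℂ)) (τ z) :=
    (contDiffAt_wirtinger hF).differentiableAt (by simp)
  have hfτ : ContDiffAt ℝ 2 (fun w => f (τ w)) z :=
    (hf.comp z hτc).of_le ENat.LEInfty.out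
  apply Complex.ofReal_injective
  rw [laplacian_eq_wirtinger hfτ, wirtingerBar_congr h1,
    wirtingerBar_mul_of_holomorphic (F := fun w => wirtinger (fun y => (f y : ℂ)) (τ w))
      (hd.comp z hτz.real_of_complex)
      ((hτ.deriv hs).differentiableAt (hs.mem_nhds hz)), wirtingerBar_comp hd hτz]
  push_cast
  rw [laplacian_eq_wirtinger (hf.of_le ENat.LEInfty.out), ← Complex.conj_mul']
  ring

end Wirtinger

/-! ### Functions on a surface given by chart-invariant local expressions -/

section Invariant

variable {X : Type*} [TopologicalSpace X] [ChartedSpace ℂ X]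

theorem chartAt_mem_overlap {e : atlas ℂ X} {x : X} (hx : x ∈ e.1.source) :
    chartAt ℂ x x ∈ overlap (chartIn x) e :=
  mem_overlap.2 ⟨mem_chart_target ℂ x, by
    rw [chartIn, (chartAt ℂ x).left_inv (mem_chart_source ℂ x)]; exact hx⟩

theorem transition_chartAt {e : atlas ℂ X} {x : X} :
    transition (chartIn x) e (chartAt ℂ x x) = e.1 x := by
  rw [transition, chartIn, (chartAt ℂ x).left_inv (mem_chart_source ℂ x)]

/-- Norms and curvature are defined through the preferred chart at `x`, which may jump as `x` moves.
Invariance under coordinate change allows a single fixed chart to be used on its whole domain, which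
is what continuity and local integration need. -/
theorem eq_of_chart_invariant {M : Type*} {F : atlas ℂ X → ℂ → M}
    (h : ∀ e e' : atlas ℂ X, ∀ z ∈ overlap e e', F e z = F e' (transition e e' z))
    {e : atlas ℂ X} {x : X} (hx : x ∈ e.1.source) :
    F (chartIn x) (chartAt ℂ x x) = F e (e.1 x) := by
  rw [h _ _ _ (chartAt_mem_overlap hx), transition_chartAt]

theorem continuous_of_chart_invariant {M : Type*} [TopologicalSpace M] {F : atlas ℂ X → ℂ → M}
    (h : ∀ e e' : atlas ℂ X, ∀ z ∈ overlap e e', F e z = F e' (transition e e' z))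
    (hc : ∀ e : atlas ℂ X, ContinuousOn (F e) e.1.target) :
    Continuous fun x => F (chartIn x) (chartAt ℂ x x) := by
  rw [continuous_iff_continuousAt]
  intro x
  have hx := mem_chart_source ℂ x
  have h1 : (fun y => F (chartIn y) (chartAt ℂ y y)) =ᶠ[nhds x]
      fun y => F (chartIn x) (chartAt ℂ x y) := by
    filter_upwards [(chartAt ℂ x).open_source.mem_nhds hx] with y hy
    exact eq_of_chart_invariant h (e := chartIn x) hy
  refine ContinuousAt.congr ?_ h1.symm
  refine ContinuousAt.comp (f := chartAt ℂ x) (g := F (chartIn x)) ?_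
    ((chartAt ℂ x).continuousAt hx)
  exact (hc (chartIn x)).continuousAt ((chartAt ℂ x).open_target.mem_nhds (mem_chart_target ℂ x))

end Invariant

/-! ### Pointwise Hermitian products and Gauss curvature -/

section Pairing

variable {X : Type*} [TopologicalSpace X] [ChartedSpace ℂ X] (g : ConformalMetric X)

namespace ConformalMetric

/-- The real part of the pointwise Hermitian inner product of two tensors of type `(p, q)`. -/
def pairing {p q : ℤ} (φ ψ : SmoothTensor X p q) (x : X) : ℝ :=
  (2 / g.density (chartIn x) (chartAt ℂ x x)) ^ (p + q) *
    (conj (φ.1 (chartIn x) (chartAt ℂ x x)) * ψ.1 (chartIn x) (chartAt ℂ x x)).re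

variable {g} {p q : ℤ} (φ ψ χ : SmoothTensor X p q) (x : X)

theorem pairing_self : g.pairing φ φ x = g.normSq φ x := by
  rw [pairing, normSq, Complex.conj_mul']; norm_cast

theorem pairing_comm : g.pairing φ ψ x = g.pairing ψ φ x := by
  simp only [pairing, Complex.mul_re, Complex.conj_re, Complex.conj_im]; ring

theorem pairing_add_right : g.pairing φ (ψ + χ) x = g.pairing φ ψ x + g.pairing φ χ x := by
  simp only [pairing, Submodule.coe_add, Pi.add_apply, mul_add, Complex.add_re]

theorem pairing_smul_right (t : ℝ) : g.pairing φ (t • ψ) x = t * g.pairing φ ψ x := by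
  have h : (t • ψ).1 (chartIn x) (chartAt ℂ x x) = t * ψ.1 (chartIn x) (chartAt ℂ x x) := by
    simp
  simp only [pairing, h, Complex.mul_re, Complex.mul_im, Complex.conj_re, Complex.conj_im,
    Complex.ofReal_re, Complex.ofReal_im]
  ring

theorem pairing_add_left : g.pairing (φ + ψ) χ x = g.pairing φ χ x + g.pairing ψ χ x := by
  rw [pairing_comm, pairing_add_right, pairing_comm χ, pairing_comm χ]

theorem pairing_smul_left (t : ℝ) : g.pairing (t • φ) ψ x = t * g.pairing φ ψ x := by
  rw [pairing_comm, pairing_smul_right, pairing_comm]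

theorem normSq_add_smul (t : ℝ) :
    g.normSq (φ + t • ψ) x = g.normSq φ x + 2 * t * g.pairing φ ψ x + t ^ 2 * g.normSq ψ x := by
  simp only [← pairing_self, pairing_add_right, pairing_add_left, pairing_smul_left,
    pairing_smul_right, pairing_comm ψ φ]
  ring

theorem density_pos (x : X) : 0 < g.density (chartIn x) (chartAt ℂ x x) :=
  g.pos _ _ (mem_chart_target ℂ x)

theorem normSq_nonneg : 0 ≤ g.normSq φ x :=
  mul_nonneg (zpow_nonneg (div_nonneg zero_le_two (density_pos x).le) _) (sq_nonneg _)

theorem contDiffAt_log_density (g : ConformalMetric X) (e : atlas ℂ X) {z : ℂ}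
    (hz : z ∈ e.1.target) : ContDiffAt ℝ ∞ (fun z => Real.log (g.density e z)) z :=
  ((g.smooth e).contDiffAt (e.1.open_target.mem_nhds hz)).log (g.pos e z hz).ne'

variable [IsManifold 𝓘(ℂ) ω X]

/-- With d the derivative of the coordinate change, the coefficients contribute |d|^{2(p+q)} and the
density contributes its inverse through (2/ρ)^{p+q}. -/
theorem pairing_transform (e e' : atlas ℂ X) (z : ℂ) (hz : z ∈ overlap e e') :
    (2 / g.density e z) ^ (p + q) * (conj (φ.1 e z) * ψ.1 e z).re =
      (2 / g.density e' (transition e e' z)) ^ (p + q) *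
        (conj (φ.1 e' (transition e e' z)) * ψ.1 e' (transition e e' z)).re := by
  have hd := deriv_transition_ne_zero hz
  have hρ := g.pos e' _ (transition_mem_target hz)
  rw [φ.2.2.2 e e' z hz, ψ.2.2.2 e e' z hz, g.transform e e' z hz]
  set d := deriv (transition e e') z
  set a := φ.1 e' (transition e e' z)
  set b := ψ.1 e' (transition e e' z)
  have hn : ‖d‖ ≠ 0 := norm_ne_zero_iff.2 hd
  have h1 : conj (a * (d ^ p * conj d ^ q)) * (b * (d ^ p * conj d ^ q)) =
      ((‖d‖ ^ 2) ^ (p + q) : ℝ) * (conj a * b) := by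
    have h2 : ((‖d‖ ^ 2 : ℝ) : ℂ) = d * conj d := by
      rw [Complex.mul_conj']; push_cast; rfl
    have hd' : conj d ≠ 0 := (map_ne_zero _).2 hd
    rw [Complex.ofReal_zpow, h2, map_mul, map_mul, map_zpow₀, map_zpow₀, Complex.conj_conj,
      mul_zpow, zpow_add₀ hd, zpow_add₀ hd']
    ring
  rw [h1, Complex.re_ofReal_mul, ← mul_assoc, ← mul_zpow]
  congr 2
  field_simp

theorem continuous_pairing : Continuous (g.pairing φ ψ) := by
  refine continuous_of_chart_invariant (F := fun e z =>
    (2 / g.density e z) ^ (p + q) * (conj (φ.1 e z) * ψ.1 e z).re)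
    (pairing_transform φ ψ) fun e => ?_
  refine ContinuousOn.mul ?_ ?_
  · refine ContinuousOn.zpow₀ (continuousOn_const.div (g.smooth e).continuousOn
      fun z hz => (g.pos e z hz).ne') _ fun z hz => Or.inl ?_
    exact (div_pos zero_lt_two (g.pos e z hz)).ne'
  · exact Complex.continuous_re.comp_continuousOn
      ((Complex.continuous_conj.comp_continuousOn (φ.2.1 e).continuousOn).mul
        (ψ.2.1 e).continuousOn)

theorem continuous_normSq : Continuous (g.normSq φ) := by
  have := continuous_pairing (g := g) φ φ
  simpa only [funext fun x => pairing_self (g := g) φ x] using this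

/-- The expression for the Gauss curvature does not depend on the chart. -/
theorem gaussCurvature_transform (g : ConformalMetric X) (e e' : atlas ℂ X) (z : ℂ)
    (hz : z ∈ overlap e e') :
    -Laplacian.laplacian (fun z => Real.log (g.density e z)) z / (2 * g.density e z) =
      -Laplacian.laplacian (fun z => Real.log (g.density e' z)) (transition e e' z) /
        (2 * g.density e' (transition e e' z)) := by
  have hd := deriv_transition_ne_zero hz
  have hn : ‖deriv (transition e e') z‖ ≠ 0 := norm_ne_zero_iff.2 hd
  have hρ := g.pos e' _ (transition_mem_target hz)
  have ho := isOpen_overlap e e'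
  have hL := contDiffAt_log_density g e' (transition_mem_target hz)
  have hτ : ContDiffAt ℝ ∞ (transition e e') z :=
    (((differentiableOn_transition e e').contDiffOn ho : ContDiffOn ℂ ∞ _ _).contDiffAt
      (ho.mem_nhds hz)).restrict_scalars ℝ
  have han : AnalyticAt ℂ (deriv (transition e e')) z :=
    ((differentiableOn_transition e e').deriv ho).analyticAt (ho.mem_nhds hz)
  -- On the overlap log ρ_e = log ρ_{e'} ∘ τ + 2 log|τ'|. The last term is harmonic since τ' is
  -- holomorphic and nonzero, so the Laplacian sees only the first.
  have hh := han.harmonicAt_log_norm hd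
  have hev : (fun z => Real.log (g.density e z)) =ᶠ[nhds z]
      (fun w => Real.log (g.density e' (transition e e' w))) +
        (2 : ℝ) • fun w => Real.log ‖deriv (transition e e') w‖ := by
    filter_upwards [ho.mem_nhds hz] with w hw
    rw [g.transform e e' w hw, Real.log_mul (g.pos e' _ (transition_mem_target hw)).ne'
      (pow_ne_zero _ (norm_ne_zero_iff.2 (deriv_transition_ne_zero hw))), Real.log_pow]
    simp
  have hLτ : ContDiffAt ℝ 2 (fun w => Real.log (g.density e' (transition e e' w))) z :=
    (hL.comp z hτ).of_le ENat.LEInfty.out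
  have hlog : ContDiffAt ℝ 2 ((2 : ℝ) • fun w => Real.log ‖deriv (transition e e') w‖) z :=
    ContDiffAt.const_smul (f := fun w => Real.log ‖deriv (transition e e') w‖) (2 : ℝ) hh.1
  rw [(InnerProductSpace.laplacian_congr_nhds hev).eq_of_nhds,
    ContDiffAt.laplacian_add hLτ hlog,
    InnerProductSpace.laplacian_smul _ hh.1, hh.2.eq_of_nhds,
    laplacian_comp_holomorphic ho hz (differentiableOn_transition e e') hL, g.transform e e' z hz]
  simp only [Pi.zero_apply, smul_zero, add_zero]
  field_simp

theorem continuous_gaussCurvature (g : ConformalMetric X) : Continuous g.gaussCurvature := by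
  refine continuous_of_chart_invariant (F := fun e z =>
    -Laplacian.laplacian (fun z => Real.log (g.density e z)) z / (2 * g.density e z))
    (gaussCurvature_transform g) fun e => ?_
  refine ContinuousOn.div (ContinuousOn.neg ?_)
    (continuousOn_const.mul (g.smooth e).continuousOn)
    fun z hz => mul_ne_zero two_ne_zero (g.pos e z hz).ne'
  -- Continuity is read off from 4 ∂²/∂z̄∂z, since Wirtinger derivatives of smooth functions are
  -- already known to be smooth.
  have h : ContinuousOn (fun z => (4 * wirtingerBar (wirtinger
      (fun w => (Real.log (g.density e w) : ℂ))) z).re) e.1.target := by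
    have hs : ContDiffOn ℝ ∞ (fun w => (Real.log (g.density e w) : ℂ)) e.1.target := fun z hz =>
      (Complex.ofRealCLM.contDiff.contDiffAt.comp z
        (contDiffAt_log_density g e hz)).contDiffWithinAt
    exact Complex.continuous_re.comp_continuousOn (continuousOn_const.mul
      (contDiffOn_wirtingerBar e.1.open_target
        (contDiffOn_wirtinger e.1.open_target hs)).continuousOn)
  refine h.congr fun z hz => ?_
  beta_reduce
  rw [← laplacian_eq_wirtinger ((contDiffAt_log_density g e hz).of_le ENat.LEInfty.out),
    Complex.ofReal_re]

end ConformalMetric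

end Pairing

/-! ### The area measure in a chart -/

section Area

variable {X : Type*} [TopologicalSpace X] [ChartedSpace ℂ X] [MeasurableSpace X]

namespace ConformalMetric

variable (g : ConformalMetric X)

/-- The area measure of the domain of a chart. -/
def chartMeasure (e : atlas ℂ X) : Measure X :=
  Measure.map e.1.symm
    ((volume.restrict e.1.target).withDensity fun z => ENNReal.ofReal (g.density e z))

theorem area_eq : g.area = ⨆ e : atlas ℂ X, g.chartMeasure e := rfl

variable [BorelSpace X]

theorem aemeasurable_symm (e : atlas ℂ X) : AEMeasurable e.1.symm
    ((volume.restrict e.1.target).withDensity fun z => ENNReal.ofReal (g.density e z)) :=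
  (e.1.continuousOn_symm.aemeasurable e.1.open_target.measurableSet).mono_ac
    (withDensity_absolutelyContinuous _ _)

omit [MeasurableSpace X] [BorelSpace X] in
theorem aemeasurable_density (e : atlas ℂ X) :
    AEMeasurable (fun z => ENNReal.ofReal (g.density e z)) (volume.restrict e.1.target) :=
  ((g.smooth e).continuousOn.aemeasurable e.1.open_target.measurableSet).ennreal_ofReal

theorem chartMeasure_apply (e : atlas ℂ X) {S : Set X} (hS : MeasurableSet S) :
    g.chartMeasure e S =
      ∫⁻ z in e.1.target ∩ e.1.symm ⁻¹' S, ENNReal.ofReal (g.density e z) := by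
  rw [chartMeasure, Measure.map_apply_of_aemeasurable (g.aemeasurable_symm e) hS,
    withDensity_apply', Measure.restrict_restrict' e.1.open_target.measurableSet, Set.inter_comm]

theorem measurableSet_target_inter_preimage (e : atlas ℂ X) {S : Set X} (hS : MeasurableSet S) :
    MeasurableSet (e.1.target ∩ e.1.symm ⁻¹' S) := by
  have h := (continuousOn_iff_continuous_domRestrict.1 e.1.continuousOn_symm).measurable hS
  have h2 := e.1.open_target.measurableSet.subtype_image h
  convert h2 using 1
  ext z
  simp [and_comm]

/-- The real Jacobian of a holomorphic map is |τ'|², exactly the factor by which the density of a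
conformal metric changes. -/
theorem det_smul_one (c : ℂ) : (c • (1 : ℂ →L[ℝ] ℂ)).det = ‖c‖ ^ 2 := by
  have h : ((c • (1 : ℂ →L[ℝ] ℂ) : ℂ →L[ℝ] ℂ) : ℂ →ₗ[ℝ] ℂ) =
      ((LinearMap.mulLeft ℂ c).restrictScalars ℝ) := by
    ext; simp
  rw [ContinuousLinearMap.det, h, LinearMap.det_restrictScalars, LinearMap.det_ring]
  simp [Algebra.norm_complex_apply, Complex.normSq_eq_norm_sq]

variable [IsManifold 𝓘(ℂ) ω X]

/-- The coordinate change carries the part of `S` visible in `e'` injectively into the part visible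
in `e`, and the change of variables formula preserves ρ dx dy. Only an inequality holds, because
`e'` need not cover `S`. -/
theorem chartMeasure_le_of_subset (e e' : atlas ℂ X) {S : Set X} (hS : MeasurableSet S)
    (hSe : S ⊆ e.1.source) : g.chartMeasure e' S ≤ g.chartMeasure e S := by
  rw [chartMeasure_apply g e hS, chartMeasure_apply g e' hS]
  set A := e'.1.target ∩ e'.1.symm ⁻¹' S
  have hA : MeasurableSet A := measurableSet_target_inter_preimage e' hS
  have hAo : ∀ z ∈ A, z ∈ overlap e' e := fun z hz => mem_overlap.2 ⟨hz.1, hSe hz.2⟩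
  have hinj : Set.InjOn (transition e' e) A := by
    intro z hz w hw h
    rw [← transition_transition (hAo z hz), h, transition_transition (hAo w hw)]
  have hd : ∀ z ∈ A, HasFDerivWithinAt (transition e' e)
      (deriv (transition e' e) z • (1 : ℂ →L[ℝ] ℂ)) A z := fun z hz =>
    (differentiableAt_transition (hAo z hz)).hasDerivAt.complexToReal_fderiv.hasFDerivWithinAt
  have him : transition e' e '' A ⊆ e.1.target ∩ e.1.symm ⁻¹' S := by
    rintro _ ⟨z, hz, rfl⟩
    refine ⟨transition_mem_target (hAo z hz), ?_⟩
    rw [Set.mem_preimage, transition, e.1.left_inv (hSe hz.2)]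
    exact hz.2
  calc ∫⁻ z in A, ENNReal.ofReal (g.density e' z)
      = ∫⁻ z in A, ENNReal.ofReal |(deriv (transition e' e) z • (1 : ℂ →L[ℝ] ℂ)).det| *
          ENNReal.ofReal (g.density e (transition e' e z)) := by
        refine setLIntegral_congr_fun hA fun z hz => ?_
        rw [g.transform e' e z (hAo z hz), det_smul_one, abs_of_nonneg (sq_nonneg _),
          mul_comm, ENNReal.ofReal_mul (sq_nonneg _)]
    _ = ∫⁻ z in transition e' e '' A, ENNReal.ofReal (g.density e z) :=
        (lintegral_image_eq_lintegral_abs_det_fderiv_mul volume hA hd hinj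
          fun z => ENNReal.ofReal (g.density e z)).symm
    _ ≤ _ := lintegral_mono_set him

/-- On the domain of a chart the area measure is given by the local formula. -/
theorem area_apply_of_subset (e : atlas ℂ X) {S : Set X} (hS : MeasurableSet S)
    (hSe : S ⊆ e.1.source) : g.area S = g.chartMeasure e S := by
  refine le_antisymm ?_ (by rw [area_eq]; exact le_iSup g.chartMeasure e S)
  have hs := e.1.open_source.measurableSet
  -- A supremum of measures is not computed set by set, so an upper bound must itself be a measure:
  -- infinite mass is put off the domain of `e`, where nothing is claimed.
  have hle : g.area ≤ g.chartMeasure e + (⊤ : Measure X).restrict e.1.sourceᶜ := by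
    rw [area_eq]
    refine iSup_le fun e' => ?_
    rw [← Measure.restrict_add_restrict_compl (μ := g.chartMeasure e') hs]
    refine add_le_add ?_ (Measure.restrict_mono le_rfl le_top)
    refine Measure.le_iff.2 fun T hT => ?_
    rw [Measure.restrict_apply hT]
    exact (g.chartMeasure_le_of_subset e e' (hT.inter hs) Set.inter_subset_right).trans
      (measure_mono Set.inter_subset_left)
  refine (hle S).trans ?_
  rw [Measure.add_apply, Measure.restrict_apply hS]
  have : S ∩ e.1.sourceᶜ = ∅ := by
    rw [← Set.sdiff_eq, Set.sdiff_eq_empty.2 hSe]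
  simp [this]

theorem area_restrict_source (e : atlas ℂ X) :
    g.area.restrict e.1.source = g.chartMeasure e := by
  have hs := e.1.open_source.measurableSet
  ext S hS
  rw [Measure.restrict_apply hS, g.area_apply_of_subset e (hS.inter hs) Set.inter_subset_right,
    g.chartMeasure_apply e (hS.inter hs), g.chartMeasure_apply e hS]
  congr 2
  ext z
  simp only [Set.mem_inter_iff, Set.mem_preimage]
  exact ⟨fun h => ⟨h.1, h.2.1⟩, fun h => ⟨h.1, h.2, e.1.map_target h.1⟩⟩

/-- The integral of a function supported in the domain of a chart. -/
theorem integral_area_eq (e : atlas ℂ X) {F : X → ℝ} (hF : Continuous F)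
    (h0 : ∀ x ∉ e.1.source, F x = 0) :
    ∫ x, F x ∂g.area = ∫ z in e.1.target, g.density e z * F (e.1.symm z) := by
  rw [← setIntegral_eq_integral_of_forall_compl_eq_zero h0, area_restrict_source, chartMeasure,
    integral_map (g.aemeasurable_symm e) hF.measurable.aestronglyMeasurable,
    integral_withDensity_eq_integral_toReal_smul₀ (g.aemeasurable_density e)
      (Filter.Eventually.of_forall fun _ => ENNReal.ofReal_lt_top)]
  refine setIntegral_congr_fun e.1.open_target.measurableSet fun z hz => ?_
  simp [ENNReal.toReal_ofReal (g.pos e z hz).le]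

/-- The density is positive in every chart. This is what makes the integral of a nonnegative
continuous function strictly positive once the function is nonzero somewhere. -/
instance isOpenPosMeasure_area : g.area.IsOpenPosMeasure := by
  refine ⟨fun U hU hne h0 => ?_⟩
  obtain ⟨x, hx⟩ := hne
  set e : atlas ℂ X := chartIn x
  have hs := e.1.open_source
  have h1 : g.chartMeasure e (U ∩ e.1.source) = 0 := by
    rw [← g.area_apply_of_subset e (hU.inter hs).measurableSet Set.inter_subset_right]
    exact measure_mono_null Set.inter_subset_left h0
  rw [g.chartMeasure_apply e (hU.inter hs).measurableSet] at h1
  set A := e.1.target ∩ e.1.symm ⁻¹' (U ∩ e.1.source)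
  have hA : IsOpen A := e.1.symm.isOpen_inter_preimage (hU.inter hs)
  have hAne : chartAt ℂ x x ∈ A := by
    have hl := (chartAt ℂ x).left_inv (mem_chart_source ℂ x)
    refine ⟨mem_chart_target ℂ x, ?_⟩
    change (chartAt ℂ x).symm (chartAt ℂ x x) ∈ U ∩ (chartAt ℂ x).source
    rw [hl]
    exact ⟨hx, mem_chart_source ℂ x⟩
  have hm : AEMeasurable (fun z => ENNReal.ofReal (g.density e z)) (volume.restrict A) :=
    (g.aemeasurable_density e).mono_measure (Measure.restrict_mono Set.inter_subset_left le_rfl)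
  rw [lintegral_eq_zero_iff' hm, Filter.EventuallyEq, ae_restrict_iff' hA.measurableSet] at h1
  have h2 : ∀ᵐ z ∂(volume : Measure ℂ), z ∉ A := by
    filter_upwards [h1] with z hz hzA
    exact (ENNReal.ofReal_pos.2 (g.pos e z hzA.1)).ne' (hz hzA)
  exact (hA.measure_pos volume ⟨_, hAne⟩).ne' (by simpa [ae_iff] using h2)

variable [T2Space X] [CompactSpace X]

/-- A compact neighbourhood inside a chart has compact image, on which the density is bounded; local
finiteness then becomes finiteness by compactness of the surface. -/
instance isFiniteMeasure_area : IsFiniteMeasure g.area := by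
  have : IsLocallyFiniteMeasure g.area := by
    refine ⟨fun x => ?_⟩
    set e : atlas ℂ X := chartIn x
    obtain ⟨K, hK, hxK, hKs⟩ := exists_compact_subset e.1.open_source (mem_chart_source ℂ x)
    refine ⟨K, mem_interior_iff_mem_nhds.1 hxK, ?_⟩
    have hKm := hK.measurableSet
    rw [g.area_apply_of_subset e hKm hKs, g.chartMeasure_apply e hKm]
    have hsub : e.1.target ∩ e.1.symm ⁻¹' K ⊆ e.1 '' K := fun z hz =>
      ⟨e.1.symm z, hz.2, e.1.right_inv hz.1⟩
    have himg : IsCompact (e.1 '' K) := hK.image_of_continuousOn (e.1.continuousOn.mono hKs)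
    have hit : e.1 '' K ⊆ e.1.target := by
      rintro _ ⟨y, hy, rfl⟩; exact e.1.map_source (hKs hy)
    obtain ⟨M, hM⟩ := himg.bddAbove_image ((g.smooth e).continuousOn.mono hit)
    calc ∫⁻ z in e.1.target ∩ e.1.symm ⁻¹' K, ENNReal.ofReal (g.density e z)
        ≤ ∫⁻ z in e.1 '' K, ENNReal.ofReal (g.density e z) := lintegral_mono_set hsub
      _ ≤ ∫⁻ _ in e.1 '' K, ENNReal.ofReal M :=
          setLIntegral_mono measurable_const fun z hz =>
            ENNReal.ofReal_le_ofReal (hM (Set.mem_image_of_mem _ hz))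
      _ < ⊤ := by
          rw [setLIntegral_const]
          exact ENNReal.mul_lt_top ENNReal.ofReal_lt_top himg.measure_lt_top
  exact CompactSpace.isFiniteMeasure

theorem integrable_area {F : X → ℝ} (hF : Continuous F) : Integrable F g.area :=
  hF.integrable_of_hasCompactSupport (HasCompactSupport.of_compactSpace F)

end ConformalMetric

end Area

/-! ### Algebra of tensors -/

section TensorAlgebra

variable {X : Type*} [TopologicalSpace X] [ChartedSpace ℂ X]

theorem contDiffOn_conj {F : ℂ → ℂ} {s : Set ℂ} (hF : ContDiffOn ℝ ∞ F s) :
    ContDiffOn ℝ ∞ (fun z => conj (F z)) s :=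
  Complex.conjCLE.contDiff.comp_contDiffOn hF

/-- The complex conjugate of a tensor. -/
def tconj {p q : ℤ} (φ : SmoothTensor X p q) : SmoothTensor X q p :=
  ⟨fun e z => conj (φ.1 e z), by
    obtain ⟨h1, h2, h3⟩ := φ.2
    refine ⟨fun e => contDiffOn_conj (h1 e), fun e z hz => by simp [h2 e z hz],
      fun e e' z hz => ?_⟩
    beta_reduce
    rw [h3 e e' z hz]
    simp only [map_mul, map_zpow₀, Complex.conj_conj]
    ring⟩

/-- The conformal metric as a tensor of type `(1, 1)`. -/
def ConformalMetric.tensor (g : ConformalMetric X) : SmoothTensor X 1 1 :=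
  ⟨fun e => e.1.target.indicator fun z => (g.density e z : ℂ), by
    refine ⟨fun e => ?_, fun e z hz => Set.indicator_of_notMem hz _, fun e e' z hz => ?_⟩
    · exact (Complex.ofRealCLM.contDiff.comp_contDiffOn (g.smooth e)).congr fun z hz =>
        Set.indicator_of_mem hz _
    · beta_reduce
      rw [Set.indicator_of_mem (mem_overlap.1 hz).1,
        Set.indicator_of_mem (transition_mem_target hz), g.transform e e' z hz, zpow_one,
        zpow_one, Complex.mul_conj']
      push_cast; rfl⟩

variable [IsManifold 𝓘(ℂ) ω X]

/-- The product of two tensors. -/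
def tmul {p q p' q' r s : ℤ} (hp : p + p' = r) (hq : q + q' = s) (φ : SmoothTensor X p q)
    (ψ : SmoothTensor X p' q') : SmoothTensor X r s :=
  ⟨fun e z => φ.1 e z * ψ.1 e z, by
    obtain ⟨h1, h2, h3⟩ := φ.2
    obtain ⟨k1, k2, k3⟩ := ψ.2
    refine ⟨fun e => (h1 e).mul (k1 e), fun e z hz => by simp [h2 e z hz], fun e e' z hz => ?_⟩
    have hd := deriv_transition_ne_zero hz
    beta_reduce
    rw [h3 e e' z hz, k3 e e' z hz, ← hp, ← hq, zpow_add₀ hd, zpow_add₀ ((map_ne_zero _).2 hd)]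
    ring⟩

/-- The product of a smooth function and a tensor. -/
def fsmul {p q : ℤ} (v : SmoothFun X) (φ : SmoothTensor X p q) : SmoothTensor X p q :=
  ⟨fun e z => (v (e.1.symm z) : ℂ) * φ.1 e z, by
    obtain ⟨h1, h2, h3⟩ := φ.2
    refine ⟨fun e => ?_, fun e z hz => by simp [h2 e z hz], fun e e' z hz => ?_⟩
    · exact (Complex.ofRealCLM.contDiff.comp_contDiffOn (contDiffOn_chart v e)).mul (h1 e)
    · beta_reduce
      rw [h3 e e' z hz, transition, e'.1.left_inv (mem_overlap.1 hz).2]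
      ring⟩

omit [IsManifold 𝓘(ℂ) ω X] in
theorem contDiffAt_tensor {p q : ℤ} (φ : SmoothTensor X p q) {e : atlas ℂ X} {z : ℂ}
    (hz : z ∈ e.1.target) : ContDiffAt ℝ ∞ (φ.1 e) z :=
  (φ.2.1 e).contDiffAt (e.1.open_target.mem_nhds hz)

theorem contDiffAt_chart (u : SmoothFun X) {e : atlas ℂ X} {z : ℂ} (hz : z ∈ e.1.target) :
    ContDiffAt ℝ ∞ (fun z => (u (e.1.symm z) : ℂ)) z :=
  Complex.ofRealCLM.contDiff.contDiffAt.comp z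
    ((contDiffOn_chart u e).contDiffAt (e.1.open_target.mem_nhds hz))

theorem delbar_apply {p : ℤ} (φ : SmoothTensor X p 0) {e : atlas ℂ X} {z : ℂ}
    (hz : z ∈ e.1.target) : (delbar φ).1 e z = wirtingerBar (φ.1 e) z :=
  Set.indicator_of_mem hz _

theorem del_apply (u : SmoothFun X) {e : atlas ℂ X} {z : ℂ} (hz : z ∈ e.1.target) :
    (del u).1 e z = wirtinger (fun z => (u (e.1.symm z) : ℂ)) z :=
  Set.indicator_of_mem hz _

omit [IsManifold 𝓘(ℂ) ω X] in
theorem tensor_ext {p q : ℤ} {φ ψ : SmoothTensor X p q}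
    (h : ∀ e : atlas ℂ X, ∀ z ∈ e.1.target, φ.1 e z = ψ.1 e z) : φ = ψ := by
  ext e z
  by_cases hz : z ∈ e.1.target
  · exact h e z hz
  · rw [φ.2.2.1 e z hz, ψ.2.2.1 e z hz]

theorem delbar_add {p : ℤ} (φ ψ : SmoothTensor X p 0) :
    delbar (φ + ψ) = delbar φ + delbar ψ := by
  refine tensor_ext fun e z hz => ?_
  rw [Submodule.coe_add, Pi.add_apply, Pi.add_apply, delbar_apply _ hz, delbar_apply _ hz,
    delbar_apply _ hz]
  exact wirtingerBar_add ((contDiffAt_tensor φ hz).differentiableAt (by simp))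
    ((contDiffAt_tensor ψ hz).differentiableAt (by simp))

omit [IsManifold 𝓘(ℂ) ω X] in
theorem smul_apply_real {p q : ℤ} (t : ℝ) (φ : SmoothTensor X p q) (e : atlas ℂ X) (z : ℂ) :
    (t • φ).1 e z = t * φ.1 e z := by
  simp

theorem delbar_smul {p : ℤ} (t : ℝ) (φ : SmoothTensor X p 0) :
    delbar (t • φ) = t • delbar φ := by
  refine tensor_ext fun e z hz => ?_
  rw [smul_apply_real, delbar_apply _ hz, delbar_apply _ hz]
  have h : (t • φ).1 e = fun z => (t : ℂ) * φ.1 e z := funext fun z => smul_apply_real t φ e z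
  rw [h]
  exact wirtingerBar_const_mul t ((contDiffAt_tensor φ hz).differentiableAt (by simp))

theorem del_add (u v : SmoothFun X) : del (u + v) = del u + del v := by
  refine tensor_ext fun e z hz => ?_
  rw [Submodule.coe_add, Pi.add_apply, Pi.add_apply, del_apply _ hz, del_apply _ hz,
    del_apply _ hz]
  rw [← wirtinger_add ((contDiffAt_chart u hz).differentiableAt (by simp))
    ((contDiffAt_chart v hz).differentiableAt (by simp))]
  simp

theorem del_smul (t : ℝ) (u : SmoothFun X) : del (t • u) = t • del u := by
  refine tensor_ext fun e z hz => ?_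
  rw [smul_apply_real, del_apply _ hz, del_apply _ hz]
  rw [← wirtinger_const_mul t ((contDiffAt_chart u hz).differentiableAt (by simp))]
  simp

end TensorAlgebra

/-! ### The divergence theorem -/

theorem integral_fderiv_apply_eq_zero {f : ℂ → ℂ} (hf : ContDiff ℝ 1 f) (hc : HasCompactSupport f)
    (v : ℂ) : ∫ z, fderiv ℝ f z v = 0 := by
  have hi : Integrable (fun z => fderiv ℝ f z v) :=
    ((hf.continuous_fderiv (by simp)).clm_apply continuous_const).integrable_of_hasCompactSupport
      (hc.fderiv_apply (𝕜 := ℝ) v)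
  -- Integration by parts against the constant function 1.
  have h := integral_smul_fderiv_eq_neg_fderiv_smul_of_integrable (μ := volume)
    (f := fun _ : ℂ => (1 : ℝ)) (g := f) (v := v) (by simp) (by simpa using hi)
    (by simpa using hf.continuous.integrable_of_hasCompactSupport hc)
    (fun _ _ => differentiableAt_const _) (fun z _ => hf.differentiable (by simp) z)
  simpa using h

theorem integral_re_wirtingerBar_eq_zero {f : ℂ → ℂ} (hf : ContDiff ℝ 1 f)
    (hc : HasCompactSupport f) : ∫ z, (wirtingerBar f z).re = 0 := by
  have hi : ∀ v, Integrable (fun z => fderiv ℝ f z v) := fun v =>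
    ((hf.continuous_fderiv (by simp)).clm_apply continuous_const).integrable_of_hasCompactSupport
      (hc.fderiv_apply (𝕜 := ℝ) v)
  have h : ∫ z, wirtingerBar f z = 0 := by
    unfold wirtingerBar
    rw [integral_div, integral_add (hi 1) ((hi Complex.I).const_mul _), integral_const_mul,
      integral_fderiv_apply_eq_zero hf hc, integral_fderiv_apply_eq_zero hf hc]
    simp
  have hw : Integrable (wirtingerBar f) :=
    ((hi 1).add ((hi Complex.I).const_mul Complex.I)).div_const 2
  have := integral_re hw
  simp only [RCLike.re_eq_complex_re] at this
  rw [this, h, Complex.zero_re]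

section Divergence

variable {X : Type*} [TopologicalSpace X] [ChartedSpace ℂ X] [IsManifold 𝓘(ℂ) ω X]

namespace ConformalMetric

variable (g : ConformalMetric X)

omit [IsManifold 𝓘(ℂ) ω X] in
theorem tensor_apply {e : atlas ℂ X} {z : ℂ} (hz : z ∈ e.1.target) :
    g.tensor.1 e z = g.density e z :=
  Set.indicator_of_mem hz fun z => (g.density e z : ℂ)

theorem pairing_symm_apply {p q : ℤ} (φ ψ : SmoothTensor X p q) {e : atlas ℂ X} {z : ℂ}
    (hz : z ∈ e.1.target) : g.pairing φ ψ (e.1.symm z) =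
      (2 / g.density e z) ^ (p + q) * (conj (φ.1 e z) * ψ.1 e z).re := by
  have h := eq_of_chart_invariant (F := fun e z =>
    (2 / g.density e z) ^ (p + q) * (conj (φ.1 e z) * ψ.1 e z).re)
    (pairing_transform φ ψ) (e.1.map_target hz)
  rw [e.1.right_inv hz] at h
  exact h

/-- Pairing with the metric is the trace that turns a (1,1)-tensor into a function. Its 1/ρ cancels
the ρ of the area measure, so integrals of traces are plain planar integrals of 4 Re φ. -/
theorem pairing_tensor_symm_apply (φ : SmoothTensor X 1 1) {e : atlas ℂ X} {z : ℂ}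
    (hz : z ∈ e.1.target) :
    g.pairing g.tensor φ (e.1.symm z) = 4 * (φ.1 e z).re / g.density e z := by
  have hρ := (g.pos e z hz).ne'
  rw [pairing_symm_apply g _ _ hz, g.tensor_apply hz, Complex.conj_ofReal, Complex.re_ofReal_mul]
  norm_num
  field_simp
  ring

theorem pairing_tensor_apply (φ : SmoothTensor X 1 1) (x : X) :
    g.pairing g.tensor φ x = 4 * (φ.1 (chartIn x) (chartAt ℂ x x)).re /
      g.density (chartIn x) (chartAt ℂ x x) := by
  have h := g.pairing_tensor_symm_apply φ (e := chartIn x) (mem_chart_target ℂ x)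
  simp only [chartIn, (chartAt ℂ x).left_inv (mem_chart_source ℂ x)] at h
  exact h

variable [MeasurableSpace X] [BorelSpace X] [T2Space X] [CompactSpace X]

omit [T2Space X] in
-- In the chart the integral becomes ∫ 4 Re ∂F/∂z̄ dx dy, where F is the coefficient of χα; it has
-- compact support in the plane.
theorem integral_divergence_of_tsupport_subset (α : SmoothTensor X 1 0) (χ : SmoothFun X)
    (e : atlas ℂ X) (hχ : tsupport χ ⊆ e.1.source) :
    ∫ x, g.pairing g.tensor (delbar (fsmul χ α)) x ∂g.area = 0 := by
  set f : ℂ → ℂ := (fsmul χ α).1 e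
  set K : Set ℂ := e.1 '' tsupport χ
  have hK : IsCompact K := (isClosed_tsupport χ).isCompact.image_of_continuousOn
    (e.1.continuousOn.mono hχ)
  have hfK : ∀ z ∉ K, f z = 0 := by
    intro z hz
    by_cases hzt : z ∈ e.1.target
    · have : e.1.symm z ∉ tsupport χ := fun h => hz ⟨_, h, e.1.right_inv hzt⟩
      change (χ (e.1.symm z) : ℂ) * _ = 0
      rw [image_eq_zero_of_notMem_tsupport this]; simp
    · exact (fsmul χ α).2.2.1 e z hzt
  have hKt : K ⊆ e.1.target := by
    rintro _ ⟨y, hy, rfl⟩; exact e.1.map_source (hχ hy)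
  have hev : ∀ z ∉ K, f =ᶠ[nhds z] fun _ => 0 := fun z hz => by
    filter_upwards [hK.isClosed.isOpen_compl.mem_nhds hz] with w hw using hfK w hw
  -- The coefficient is smooth on the chart image and vanishes near every point outside `K`, so its
  -- extension by zero is differentiable across the boundary of the image.
  have hf : ContDiff ℝ 1 f := by
    refine contDiff_iff_contDiffAt.2 fun z => ?_
    by_cases hz : z ∈ e.1.target
    · exact (contDiffAt_tensor (fsmul χ α) hz).of_le (by simp)
    · exact contDiffAt_const.congr_of_eventuallyEq (hev z fun h => hz (hKt h))
  have hfc : HasCompactSupport f := HasCompactSupport.intro hK hfK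
  have h0 : ∀ x ∉ e.1.source, g.pairing g.tensor (delbar (fsmul χ α)) x = 0 := by
    intro x hx
    have hx' : x ∉ tsupport χ := fun h => hx (hχ h)
    have hl := (chartAt ℂ x).left_inv (mem_chart_source ℂ x)
    have hc : ContinuousAt (chartAt ℂ x).symm (chartAt ℂ x x) :=
      (chartAt ℂ x).continuousAt_symm (mem_chart_target ℂ x)
    have hz : (fsmul χ α).1 (chartIn x) =ᶠ[nhds (chartAt ℂ x x)] fun _ => 0 := by
      have := hc.eventually ((isClosed_tsupport χ).isOpen_compl.mem_nhds (by rw [hl]; exact hx'))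
      filter_upwards [this] with w hw
      change (χ ((chartAt ℂ x).symm w) : ℂ) * _ = 0
      rw [image_eq_zero_of_notMem_tsupport hw]; simp
    rw [pairing_tensor_apply, delbar_apply _ (mem_chart_target ℂ x), wirtingerBar_congr hz]
    simp [wirtingerBar]
  rw [g.integral_area_eq e (continuous_pairing _ _) h0]
  have h1 : ∀ z ∈ e.1.target, g.density e z *
      g.pairing g.tensor (delbar (fsmul χ α)) (e.1.symm z) = 4 * (wirtingerBar f z).re := by
    intro z hz
    have hρ := (g.pos e z hz).ne'
    rw [g.pairing_tensor_symm_apply _ hz, delbar_apply _ hz]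
    field_simp
    rfl
  rw [setIntegral_congr_fun e.1.open_target.measurableSet h1,
    setIntegral_eq_integral_of_forall_compl_eq_zero, integral_const_mul,
    integral_re_wirtingerBar_eq_zero hf hfc, mul_zero]
  intro z hz
  rw [wirtingerBar_congr (hev z fun h => hz (hKt h))]
  simp [wirtingerBar]

/-- The divergence theorem: the integral of `∂̄α` vanishes for every `(1, 0)`-form `α`. -/
theorem integral_divergence (α : SmoothTensor X 1 0) :
    ∫ x, g.pairing g.tensor (delbar α) x ∂g.area = 0 := by
  have := isManifold_real X
  obtain ⟨t, ht⟩ := isCompact_univ.elim_finite_subcover (fun x : X => (chartAt ℂ x).source)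
    (fun x => (chartAt ℂ x).open_source)
    (fun x _ => Set.mem_iUnion.2 ⟨x, mem_chart_source ℂ x⟩)
  obtain ⟨f, hf⟩ := SmoothPartitionOfUnity.exists_isSubordinate 𝓘(ℝ, ℂ) isClosed_univ
    (fun i : t => (chartAt ℂ i.1).source) (fun i => (chartAt ℂ i.1).open_source)
    (fun x hx => by simpa using ht hx)
  -- A finite partition of unity subordinate to charts reduces the claim to forms supported in one
  -- chart.
  have hsum : α = ∑ i : t, fsmul (f i) α := by
    refine tensor_ext fun e z hz => ?_
    have h1 := f.sum_eq_one (Set.mem_univ (e.1.symm z))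
    rw [finsum_eq_sum_of_fintype] at h1
    have h2 : (∑ i : t, fsmul (f i) α).1 e z = ∑ i : t, (f i (e.1.symm z) : ℂ) * α.1 e z := by
      rw [AddSubmonoidClass.coe_finsetSum, Finset.sum_apply, Finset.sum_apply]; rfl
    rw [h2, ← Finset.sum_mul, ← Complex.ofReal_sum, h1]
    simp
  have key : ∀ s : Finset t,
      ∫ x, g.pairing g.tensor (delbar (∑ i ∈ s, fsmul (f i) α)) x ∂g.area = 0 := by
    classical
    intro s
    induction s using Finset.induction_on with
    | empty =>
      have h0 : delbar (0 : SmoothTensor X 1 0) = 0 := by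
        have := delbar_smul 0 (0 : SmoothTensor X 1 0)
        simpa using this
      simp [h0, pairing]
    | insert i s hi ih =>
      rw [Finset.sum_insert hi, delbar_add]
      simp only [pairing_add_right]
      rw [integral_add (g.integrable_area (continuous_pairing _ _))
        (g.integrable_area (continuous_pairing _ _)), ih,
        g.integral_divergence_of_tsupport_subset α (f i) (chartIn i.1) (hf i), add_zero]
  rw [hsum]
  exact key Finset.univ

end ConformalMetric

end Divergence

/-! ### A Bochner identity -/

/-- The Bochner identity in a planar domain with metric `e^L |dz|²` and weight `e^{2U}`. -/
theorem bochner_plane {U L : ℂ → ℝ} {W : ℂ → ℂ} {z : ℂ}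
    (hU : ContDiffAt ℝ ∞ (fun w => (U w : ℂ)) z) (hL : ContDiffAt ℝ ∞ (fun w => (L w : ℂ)) z)
    (hW : ContDiffAt ℝ ∞ W z)
    {k : ℝ} (hk : wirtingerBar (wirtinger fun w => (L w : ℂ)) z = k) :
    Real.exp (2 * U z) * ‖wirtingerBar W z‖ ^ 2 -
        Real.exp (2 * U z) * ‖wirtinger (fun w => (L w : ℂ)) z * W z + wirtinger W z +
          2 * wirtinger (fun w => (U w : ℂ)) z * W z‖ ^ 2 +
        4 / Real.exp (L z) * (conj (wirtinger (fun w => (U w : ℂ)) z) *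
          wirtinger (fun w => 2⁻¹ * (Complex.exp (2 * U w) *
            (Complex.exp (L w) * (W w * conj (W w))))) z).re -
        k * (Real.exp (2 * U z) * ‖W z‖ ^ 2) =
      (wirtingerBar (fun w => Complex.exp (2 * U w) *
        (Complex.exp (L w) * (W w * conj (wirtingerBar W w)) -
          conj (W w) * wirtinger (fun y => Complex.exp (L y) * W y) w)) z).re /
        Real.exp (L z) := by
  have dU : DifferentiableAt ℝ (fun w => (U w : ℂ)) z := hU.differentiableAt (by simp)
  have dL : DifferentiableAt ℝ (fun w => (L w : ℂ)) z := hL.differentiableAt (by simp)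
  have dW : DifferentiableAt ℝ W z := hW.differentiableAt (by simp)
  have dWz : DifferentiableAt ℝ (wirtinger W) z :=
    (contDiffAt_wirtinger hW).differentiableAt (by simp)
  have dWb : DifferentiableAt ℝ (wirtingerBar W) z :=
    (contDiffAt_wirtingerBar hW).differentiableAt (by simp)
  have dLz : DifferentiableAt ℝ (wirtinger fun w => (L w : ℂ)) z :=
    (contDiffAt_wirtinger hL).differentiableAt (by simp)
  have dconj : ∀ {F : ℂ → ℂ}, DifferentiableAt ℝ F z → DifferentiableAt ℝ (fun w => conj (F w)) z :=
    fun hF => Complex.conjCLE.differentiableAt.comp z hF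
  have d2U : DifferentiableAt ℝ (fun w => 2 * (U w : ℂ)) z := dU.const_mul 2
  have dE : DifferentiableAt ℝ (fun w => Complex.exp (2 * U w)) z := d2U.cexp
  have dR : DifferentiableAt ℝ (fun w => Complex.exp (L w)) z := dL.cexp
  -- With ρ = e^L, the derivative of ρW is ρ(L_z W + W_z), so the exponentials factor out and the
  -- identity is polynomial in the remaining derivatives.
  have hLW : wirtinger (fun y => Complex.exp (L y) * W y) =ᶠ[nhds z] fun w =>
      Complex.exp (L w) * (wirtinger (fun w => (L w : ℂ)) w * W w + wirtinger W w) := by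
    filter_upwards [(hL.of_le (m := 1) (by simp)).eventually (by simp),
      (hW.of_le (m := 1) (by simp)).eventually (by simp)] with w h1 h2
    have e1 := h1.differentiableAt (by simp)
    rw [wirtinger_mul e1.cexp (h2.differentiableAt (by simp)), wirtinger_cexp e1]
    ring
  have hA : (fun w => Complex.exp (2 * U w) *
        (Complex.exp (L w) * (W w * conj (wirtingerBar W w)) -
          conj (W w) * wirtinger (fun y => Complex.exp (L y) * W y) w)) =ᶠ[nhds z]
      fun w => Complex.exp (2 * U w) * (Complex.exp (L w) * (W w * conj (wirtingerBar W w) -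
          conj (W w) * (wirtinger (fun w => (L w : ℂ)) w * W w + wirtinger W w))) := by
    filter_upwards [hLW] with w hw
    rw [hw]; ring
  have d1 := dW.fun_mul (dconj dWb)
  have d2 := (dLz.fun_mul dW).fun_add dWz
  have d3 := (dconj dW).fun_mul d2
  rw [wirtingerBar_congr hA, wirtingerBar_mul dE (dR.fun_mul (d1.fun_sub d3)),
    wirtingerBar_mul dR (d1.fun_sub d3), wirtingerBar_sub d1 d3, wirtingerBar_mul dW (dconj dWb),
    wirtingerBar_mul (dconj dW) d2, wirtingerBar_add (dLz.fun_mul dW) dWz,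
    wirtingerBar_mul dLz dW, wirtingerBar_conj, wirtingerBar_conj, wirtingerBar_cexp d2U,
    wirtingerBar_cexp dL, wirtingerBar_const_mul 2 dU, wirtingerBar_ofReal, wirtingerBar_ofReal,
    wirtinger_wirtingerBar (hW.of_le ENat.LEInfty.out), hk,
    wirtinger_const_mul _ (dE.fun_mul (dR.fun_mul (dW.fun_mul (dconj dW)))),
    wirtinger_mul dE (dR.fun_mul (dW.fun_mul (dconj dW))),
    wirtinger_mul dR (dW.fun_mul (dconj dW)), wirtinger_mul dW (dconj dW), wirtinger_conj,
    wirtinger_cexp d2U, wirtinger_cexp dL, wirtinger_const_mul 2 dU]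
  have hE : Complex.exp (2 * U z) = (Real.exp (2 * U z) : ℝ) := by push_cast; rfl
  rw [hE, ← Complex.ofReal_exp]
  have hR := (Real.exp_pos (L z)).ne'
  generalize Real.exp (2 * U z) = E
  generalize Real.exp (L z) = R at hR ⊢
  -- Since ∂ and ∂̄ commute, the second derivatives of W occur only as W·conj(W_{zz̄}) -
  -- conj(W)·W_{zz̄}, which is purely imaginary. The second derivative of L is the real number `k`.
  -- All other jets may therefore be treated as independent variables, and comparing real parts is
  -- algebra.
  generalize wirtingerBar (wirtinger W) z = Wzb
  generalize wirtingerBar W z = Wb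
  generalize wirtinger W z = Wz
  generalize W z = w
  generalize wirtinger (fun w => (U w : ℂ)) z = a
  generalize wirtinger (fun w => (L w : ℂ)) z = l
  simp only [← Complex.normSq_eq_norm_sq, Complex.normSq_apply, Complex.mul_re, Complex.mul_im,
    Complex.add_re, Complex.add_im, Complex.sub_re, Complex.sub_im, Complex.conj_re,
    Complex.conj_im, Complex.ofReal_re, Complex.ofReal_im, Complex.re_ofNat, Complex.im_ofNat,
    Complex.inv_re, Complex.inv_im]
  field_simp
  ring

/-! ### The Bochner inequality on the surface -/

section Bochner

variable {X : Type*} [TopologicalSpace X] [ChartedSpace ℂ X] [IsManifold 𝓘(ℂ) ω X]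

theorem contMDiff_of_chart {f : X → ℝ}
    (h : ∀ e : atlas ℂ X, ContDiffOn ℝ ∞ (fun z => f (e.1.symm z)) e.1.target) :
    ContMDiff 𝓘(ℝ, ℂ) 𝓘(ℝ, ℝ) ∞ f := by
  have := isManifold_real X
  intro x
  have h1 : ContMDiffAt 𝓘(ℝ, ℂ) 𝓘(ℝ, ℂ) ∞ (chartAt ℂ x) x :=
    contMDiffAt_of_mem_maximalAtlas (IsManifold.subset_maximalAtlas (chart_mem_atlas ℂ x))
      (mem_chart_source ℂ x)
  have h2 := ((h (chartIn x)).contDiffAt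
    ((chartAt ℂ x).open_target.mem_nhds (mem_chart_target ℂ x))).contMDiffAt.comp x h1
  refine h2.congr_of_eventuallyEq ?_
  filter_upwards [(chartAt ℂ x).open_source.mem_nhds (mem_chart_source ℂ x)] with y hy
  simp [chartIn, (chartAt ℂ x).left_inv hy]

/-- The function `e^{2u}`. -/
def expFun (u : SmoothFun X) : SmoothFun X :=
  ⟨fun x => Real.exp (2 * u x), contMDiff_of_chart fun e =>
    (contDiffOn_const.mul (contDiffOn_chart u e)).exp⟩

namespace ConformalMetric

variable (g : ConformalMetric X)

theorem normSq_symm_apply (w : VectorField X) {e : atlas ℂ X} {z : ℂ} (hz : z ∈ e.1.target) :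
    g.normSq w (e.1.symm z) = g.density e z / 2 * ‖w.1 e z‖ ^ 2 := by
  rw [← pairing_self, pairing_symm_apply g _ _ hz, Complex.conj_mul']
  norm_num
  left
  norm_cast

/-- The squared norm of a vector field with respect to the metric `e^{2u} g`. -/
def weightedNormSq (u : SmoothFun X) (w : VectorField X) : SmoothFun X :=
  ⟨fun x => Real.exp (2 * u x) * g.normSq w x, contMDiff_of_chart fun e => by
    refine ContDiffOn.mul (contDiffOn_const.mul (contDiffOn_chart u e)).exp ?_
    refine ContDiffOn.congr (f := fun z => g.density e z / 2 * ‖w.1 e z‖ ^ 2)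
      (((g.smooth e).div_const 2).mul ((w.2.1 e).norm_sq ℝ)) fun z hz => ?_
    exact g.normSq_symm_apply w hz⟩

/-- The `(1, 0)`-form whose divergence appears in the Bochner identity; in a chart it is
`e^{2u} (ρ w conj(∂w/∂z̄) - w̄ ∂(ρ w)/∂z) dz`. -/
def bochnerForm (u : SmoothFun X) (w : VectorField X) : SmoothTensor X 1 0 :=
  fsmul (expFun u)
    (tmul (p := 1) (q := 1) (p' := 0) (q' := -1) (by norm_num) (by norm_num) g.tensor
        (tmul (p := -1) (q := 0) (p' := 1) (q' := -1) (by norm_num) (by norm_num) w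
          (tconj (delbar w))) -
      tmul (p := 0) (q := -1) (p' := 1) (q' := 1) (by norm_num) (by norm_num) (tconj w)
        (tconj (delbar (tconj (tmul (r := 0) (s := 1) (by norm_num) (by norm_num) g.tensor w)))))

/-- The product ρw has type (0,1) and its conjugate has type (1,0), where ∂̄ is defined; conjugating
back yields ∂(ρw)/∂z without a connection. Writing ρ as exp(log ρ) matches the form of
`bochner_plane`. -/
theorem bochnerForm_apply (u : SmoothFun X) (w : VectorField X) {e : atlas ℂ X} {z : ℂ}
    (hz : z ∈ e.1.target) :
    (g.bochnerForm u w).1 e z = Complex.exp (2 * u (e.1.symm z)) *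
      (Complex.exp (Real.log (g.density e z)) * (w.1 e z * conj (wirtingerBar (w.1 e) z)) -
        conj (w.1 e z) *
          wirtinger (fun y => Complex.exp (Real.log (g.density e y)) * w.1 e y) z) := by
  have hρ : ∀ y ∈ e.1.target, Complex.exp (Real.log (g.density e y)) = g.density e y := by
    intro y hy
    rw [← Complex.ofReal_exp, Real.exp_log (g.pos e y hy)]
  have h : (g.bochnerForm u w).1 e z = (Real.exp (2 * u (e.1.symm z)) : ℂ) *
      (g.tensor.1 e z * (w.1 e z * conj ((delbar w).1 e z)) -
        conj (w.1 e z) * conj ((delbar (tconj (tmul (r := 0) (s := 1) (by norm_num) (by norm_num)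
          g.tensor w))).1 e z)) := rfl
  have hw : wirtinger (fun y => Complex.exp (Real.log (g.density e y)) * w.1 e y) z =
      wirtinger (fun y => g.tensor.1 e y * w.1 e y) z := by
    refine wirtinger_congr ?_
    filter_upwards [e.1.open_target.mem_nhds hz] with y hy
    rw [hρ y hy, g.tensor_apply hy]
  have hc : conj ((delbar (tconj (tmul (r := 0) (s := 1) (by norm_num) (by norm_num)
      g.tensor w))).1 e z) = wirtinger (fun y => g.tensor.1 e y * w.1 e y) z := by
    rw [delbar_apply _ hz]
    exact (congrArg conj (wirtingerBar_conj (fun y => g.tensor.1 e y * w.1 e y) z)).trans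
      (Complex.conj_conj _)
  rw [h, hc, hw, g.tensor_apply hz, delbar_apply _ hz, hρ z hz]
  push_cast
  rfl

/-- This is `bochner_plane` with U = u and L = log ρ, after discarding the square of the Chern
derivative w_z + (log ρ + 2u)_z w of the metric e^{2u}g. In `bochnerForm` the term with 2u_z is left
out on purpose: this replaces -(Δu)h, with h = e^{2u}|w|², by 2⟨∂u, ∂h⟩, the form in which it occurs
in the first variation. -/
theorem bochner_pointwise (u : SmoothFun X) (w : VectorField X) (x : X) :
    4⁻¹ * g.pairing g.tensor (delbar (g.bochnerForm u w)) x ≤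
      Real.exp (2 * u x) * g.normSq (delbar w) x +
        2 * g.pairing (del u) (del (g.weightedNormSq u w)) x +
          g.gaussCurvature x * g.weightedNormSq u w x := by
  set e : atlas ℂ X := chartIn x
  set z : ℂ := chartAt ℂ x x
  have hz : z ∈ e.1.target := mem_chart_target ℂ x
  have hx : e.1.symm z = x := (chartAt ℂ x).left_inv (mem_chart_source ℂ x)
  have hpos := g.pos e z hz
  have hL := contDiffAt_log_density g e hz
  have hLc : ContDiffAt ℝ ∞ (fun y => (Real.log (g.density e y) : ℂ)) z :=
    Complex.ofRealCLM.contDiff.contDiffAt.comp z hL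
  set k : ℝ := Laplacian.laplacian (fun y => Real.log (g.density e y)) z / 4
  have hk : wirtingerBar (wirtinger fun y => (Real.log (g.density e y) : ℂ)) z = k := by
    have := laplacian_eq_wirtinger (hL.of_le ENat.LEInfty.out)
    simp only [k]
    push_cast
    rw [this]; ring
  have key := bochner_plane (U := fun y => u (e.1.symm y)) (contDiffAt_chart u hz) hLc
    (contDiffAt_tensor w hz) hk
  simp only [hx, Real.exp_log hpos] at key
  have hα : wirtingerBar ((g.bochnerForm u w).1 e) z = wirtingerBar _ z :=
    wirtingerBar_congr (by
      filter_upwards [e.1.open_target.mem_nhds hz] with y hy using g.bochnerForm_apply u w hy)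
  have hv : wirtinger (fun y => (g.weightedNormSq u w (e.1.symm y) : ℂ)) z =
      wirtinger (fun y => 2⁻¹ * (Complex.exp (2 * u (e.1.symm y)) *
        (Complex.exp (Real.log (g.density e y)) * (w.1 e y * conj (w.1 e y))))) z := by
    refine wirtinger_congr ?_
    filter_upwards [e.1.open_target.mem_nhds hz] with y hy
    change ((Real.exp (2 * u (e.1.symm y)) * g.normSq w (e.1.symm y) : ℝ) : ℂ) = _
    rw [g.normSq_symm_apply w hy, ← Complex.ofReal_exp, Real.exp_log (g.pos e y hy),
      Complex.mul_conj']
    push_cast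
    ring
  have t1 : g.pairing g.tensor (delbar (g.bochnerForm u w)) x =
      4 * ((wirtingerBar ((g.bochnerForm u w).1 e) z).re / g.density e z) := by
    rw [pairing_tensor_apply, delbar_apply _ hz, mul_div_assoc]
  have t2 : g.normSq (delbar w) x = ‖wirtingerBar (w.1 e) z‖ ^ 2 := by
    rw [normSq, delbar_apply _ hz]; simp [e, z]
  have t3 : g.pairing (del u) (del (g.weightedNormSq u w)) x =
      2 / g.density e z * (conj (wirtinger (fun y => (u (e.1.symm y) : ℂ)) z) *
        wirtinger (fun y => (g.weightedNormSq u w (e.1.symm y) : ℂ)) z).re := by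
    rw [pairing, del_apply _ hz, del_apply _ hz]; simp [e, z]
  have t4 : g.gaussCurvature x * g.weightedNormSq u w x =
      -(k * (Real.exp (2 * u x) * ‖w.1 e z‖ ^ 2)) := by
    have h1 : g.gaussCurvature x = -(4 * k) / (2 * g.density e z) := by
      simp only [k, gaussCurvature, mul_div_cancel₀ _ (four_ne_zero' ℝ), e, z]
    have h2 : g.weightedNormSq u w x =
        Real.exp (2 * u x) * (g.density e z / 2 * ‖w.1 e z‖ ^ 2) := by
      have := g.normSq_symm_apply w hz
      rw [hx] at this
      rw [← this]; rfl
    rw [h1, h2]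
    field_simp
    ring
  rw [t1, t2, t3, t4, hv, hα, ← key]
  have hS := mul_nonneg (Real.exp_pos (2 * u x)).le (sq_nonneg
    ‖wirtinger (fun y => (Real.log (g.density e y) : ℂ)) z * w.1 e z + wirtinger (w.1 e) z +
      2 * wirtinger (fun y => (u (e.1.symm y) : ℂ)) z * w.1 e z‖)
  have hdiv : ∀ r : ℝ, 4 / g.density e z * r = 2 * (2 / g.density e z * r) := fun r => by ring
  rw [hdiv]
  linarith

variable [MeasurableSpace X] [BorelSpace X] [T2Space X] [CompactSpace X]

/-- The curvature K̃ of e^{2u}g satisfies K̃ dμ̃ = (K - Δu) dμ. After integration by parts the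
integral is therefore ‖∂̄w‖² + ∫ K̃|w|² dμ̃ in the metric e^{2u}g, which the Bochner formula
identifies with the squared norm of the (1,0) covariant derivative. -/
theorem bochner_integral (u : SmoothFun X) (w : VectorField X) :
    0 ≤ ∫ x, (Real.exp (2 * u x) * g.normSq (delbar w) x +
        2 * g.pairing (del u) (del (g.weightedNormSq u w)) x +
          g.gaussCurvature x * g.weightedNormSq u w x) ∂g.area := by
  have h0 : ∫ x, 4⁻¹ * g.pairing g.tensor (delbar (g.bochnerForm u w)) x ∂g.area = 0 := by
    rw [integral_const_mul, g.integral_divergence, mul_zero]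
  have hu := u.contMDiff.continuous
  have hv := (g.weightedNormSq u w).contMDiff.continuous
  have h1 := continuous_normSq (g := g) (delbar w)
  have h2 := continuous_pairing (g := g) (del u) (del (g.weightedNormSq u w))
  have h3 := continuous_gaussCurvature g
  have h4 := continuous_pairing (g := g) g.tensor (delbar (g.bochnerForm u w))
  rw [← h0]
  exact integral_mono (g.integrable_area (by fun_prop)) (g.integrable_area (by fun_prop))
    (g.bochner_pointwise u w)

end ConformalMetric

end Bochner

/-! ### First and second variation of the functional -/

/-- Differentiation under the integral sign over a compact space. -/
theorem hasDerivAt_integral_of_continuous {Y : Type*} [TopologicalSpace Y] [CompactSpace Y]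
    [MeasurableSpace Y] [OpensMeasurableSpace Y] {μ : Measure Y} [IsFiniteMeasure μ]
    {F F' : ℝ → Y → ℝ} (t₀ : ℝ) (hF : ∀ t, Continuous (F t))
    (hF' : Continuous fun p : ℝ × Y => F' p.1 p.2)
    (hd : ∀ t y, HasDerivAt (fun t => F t y) (F' t y) t) :
    HasDerivAt (fun t => ∫ y, F t y ∂μ) (∫ y, F' t₀ y ∂μ) t₀ := by
  have hK : IsCompact (Metric.closedBall t₀ 1 ×ˢ (Set.univ : Set Y)) :=
    (isCompact_closedBall t₀ 1).prod isCompact_univ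
  obtain ⟨M, hM⟩ := hK.exists_bound_of_continuousOn hF'.continuousOn
  refine (hasDerivAt_integral_of_dominated_loc_of_deriv_le (bound := fun _ => M)
    (Metric.closedBall_mem_nhds t₀ one_pos)
    (Filter.Eventually.of_forall fun t => (hF t).measurable.aestronglyMeasurable)
    ((hF t₀).integrable_of_hasCompactSupport (HasCompactSupport.of_compactSpace _))
    (hF'.comp (Continuous.prodMk_right t₀)).measurable.aestronglyMeasurable
    (Filter.Eventually.of_forall fun y t ht => hM (t, y) ⟨ht, Set.mem_univ _⟩)
    (integrable_const M) (Filter.Eventually.of_forall fun y t _ => hd t y)).2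

section Variation

variable {X : Type*} [TopologicalSpace X] [ChartedSpace ℂ X] [IsManifold 𝓘(ℂ) ω X]
  (g : ConformalMetric X) (β : BeltramiForm X) (lam C : ℝ)
  (P ξ η : SmoothFun X × VectorField X)

open ConformalMetric

/-- The integrand of the first variation of the functional at `P` in the direction `η`. -/
def firstVariationDensity (x : X) : ℝ :=
  2 * g.pairing (del P.1) (del η.1) x + g.gaussCurvature x * η.1 x +
    Real.exp (2 * P.1 x) * (2 * η.1 x * (-lam / 2 + g.normSq (β + delbar P.2) x) +
      2 * g.pairing (β + delbar P.2) (delbar η.2) x)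

/-- The integrand of the second variation of the functional at `P`. -/
def hessianDensity (x : X) : ℝ :=
  2 * g.pairing (del ξ.1) (del η.1) x +
    Real.exp (2 * P.1 x) * (4 * ξ.1 x * η.1 x * (-lam / 2 + g.normSq (β + delbar P.2) x) +
      4 * ξ.1 x * g.pairing (β + delbar P.2) (delbar η.2) x +
      4 * η.1 x * g.pairing (β + delbar P.2) (delbar ξ.2) x +
      2 * g.pairing (delbar ξ.2) (delbar η.2) x)

theorem continuous_firstVariationDensity :
    Continuous (firstVariationDensity g β lam P η) := by
  have h1 := P.1.contMDiff.continuous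
  have h2 := η.1.contMDiff.continuous
  have h3 := continuous_gaussCurvature g
  have h4 := continuous_pairing (g := g) (del P.1) (del η.1)
  have h5 := continuous_normSq (g := g) (β + delbar P.2)
  have h6 := continuous_pairing (g := g) (β + delbar P.2) (delbar η.2)
  unfold firstVariationDensity
  fun_prop

theorem continuous_hessianDensity : Continuous (hessianDensity g β lam P ξ η) := by
  have h1 := P.1.contMDiff.continuous
  have h2 := η.1.contMDiff.continuous
  have h3 := ξ.1.contMDiff.continuous
  have h4 := continuous_pairing (g := g) (del ξ.1) (del η.1)
  have h5 := continuous_normSq (g := g) (β + delbar P.2)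
  have h6 := continuous_pairing (g := g) (β + delbar P.2) (delbar η.2)
  have h7 := continuous_pairing (g := g) (β + delbar P.2) (delbar ξ.2)
  have h8 := continuous_pairing (g := g) (delbar ξ.2) (delbar η.2)
  unfold hessianDensity
  fun_prop

theorem del_line (t : ℝ) : del (P + t • ξ).1 = del P.1 + t • del ξ.1 := by
  rw [Prod.fst_add, Prod.smul_fst, del_add, del_smul]

theorem delbar_line (t : ℝ) :
    β + delbar (P + t • ξ).2 = (β + delbar P.2) + t • delbar ξ.2 := by
  rw [Prod.snd_add, Prod.smul_snd, delbar_add, delbar_smul, add_assoc]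

omit [IsManifold 𝓘(ℂ) ω X] in
theorem line_apply (t : ℝ) (x : X) : (P + t • ξ).1 x = P.1 x + t * ξ.1 x := rfl

/-- Along a line the weight e^{2u} is the exponential of an affine function and |β + ∂̄f|² is
quadratic, so this one formula serves both variations. -/
theorem hasDerivAt_exp_mul {a b c d e t : ℝ} :
    HasDerivAt (fun t => Real.exp (2 * (a + t * b)) * (c + 2 * t * d + t ^ 2 * e))
      (Real.exp (2 * (a + t * b)) * (2 * b * (c + 2 * t * d + t ^ 2 * e) + 2 * (d + t * e))) t := by
  have h1 : HasDerivAt (fun t : ℝ => 2 * (a + t * b)) (2 * b) t := by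
    simpa using (((hasDerivAt_id t).mul_const b).const_add a).const_mul 2
  have h2 : HasDerivAt (fun t : ℝ => c + 2 * t * d + t ^ 2 * e) (2 * (d + t * e)) t := by
    have h3 := (((hasDerivAt_id t).const_mul 2).mul_const d).const_add c
    have h4 := (hasDerivAt_pow 2 t).mul_const e
    refine (h3.fun_add h4).congr_deriv ?_
    simp; ring
  refine (h1.exp.fun_mul h2).congr_deriv ?_
  ring

variable [MeasurableSpace X] [BorelSpace X] [T2Space X] [CompactSpace X]

theorem hasDerivAt_donaldson :
    HasDerivAt (fun t : ℝ => donaldson g β lam C (P + t • η))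
      (∫ x, firstVariationDensity g β lam P η x ∂g.area) 0 := by
  have h1 := P.1.contMDiff.continuous
  have h2 := η.1.contMDiff.continuous
  have h3 := continuous_gaussCurvature g
  have h4 := continuous_pairing (g := g) (del P.1) (del η.1)
  have h5 := continuous_normSq (g := g) (β + delbar P.2)
  have h6 := continuous_pairing (g := g) (β + delbar P.2) (delbar η.2)
  have h7 := continuous_normSq (g := g) (del P.1)
  have h8 := continuous_normSq (g := g) (del η.1)
  have h9 := continuous_normSq (g := g) (delbar η.2)
  have key := (hasDerivAt_integral_of_continuous (μ := g.area)
    (F := fun t x => (g.normSq (del P.1) x + 2 * t * g.pairing (del P.1) (del η.1) x +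
        t ^ 2 * g.normSq (del η.1) x) + g.gaussCurvature x * (P.1 x + t * η.1 x) +
      Real.exp (2 * (P.1 x + t * η.1 x)) * ((-lam / 2 + g.normSq (β + delbar P.2) x) +
        2 * t * g.pairing (β + delbar P.2) (delbar η.2) x + t ^ 2 * g.normSq (delbar η.2) x))
    (F' := fun t x => (2 * g.pairing (del P.1) (del η.1) x + 2 * t * g.normSq (del η.1) x) +
        g.gaussCurvature x * η.1 x +
      Real.exp (2 * (P.1 x + t * η.1 x)) * (2 * η.1 x * ((-lam / 2 + g.normSq (β + delbar P.2) x) +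
        2 * t * g.pairing (β + delbar P.2) (delbar η.2) x + t ^ 2 * g.normSq (delbar η.2) x) +
        2 * (g.pairing (β + delbar P.2) (delbar η.2) x + t * g.normSq (delbar η.2) x)))
    0 (fun t => by fun_prop) (by fun_prop) ?_).add_const C
  · refine (key.congr_of_eventuallyEq (Filter.Eventually.of_forall fun t => ?_)).congr_deriv ?_
    · simp only [donaldson, del_line, delbar_line, normSq_add_smul, line_apply]
      simp only [add_assoc]
    · refine integral_congr_ae (Filter.Eventually.of_forall fun x => ?_)
      simp [firstVariationDensity]
  · intro t x
    refine HasDerivAt.fun_add (HasDerivAt.fun_add ?_ ?_) hasDerivAt_exp_mul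
    · have h3 := (((hasDerivAt_id t).const_mul 2).mul_const
        (g.pairing (del P.1) (del η.1) x)).const_add (g.normSq (del P.1) x)
      have h4 := (hasDerivAt_pow 2 t).mul_const (g.normSq (del η.1) x)
      refine (h3.fun_add h4).congr_deriv ?_
      simp
    · simpa using (((hasDerivAt_id t).mul_const (η.1 x)).const_add (P.1 x)).const_mul
        (g.gaussCurvature x)

theorem hasDerivAt_firstVariation :
    HasDerivAt (fun s : ℝ => ∫ x, firstVariationDensity g β lam (P + s • ξ) η x ∂g.area)
      (∫ x, hessianDensity g β lam P ξ η x ∂g.area) 0 := by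
  have h1 := P.1.contMDiff.continuous
  have h2 := η.1.contMDiff.continuous
  have h3 := ξ.1.contMDiff.continuous
  have h5 := continuous_normSq (g := g) (β + delbar P.2)
  have h6 := continuous_pairing (g := g) (β + delbar P.2) (delbar η.2)
  have h7 := continuous_pairing (g := g) (β + delbar P.2) (delbar ξ.2)
  have h8 := continuous_pairing (g := g) (del ξ.1) (del η.1)
  have h9 := continuous_pairing (g := g) (delbar ξ.2) (delbar η.2)
  have h10 := continuous_normSq (g := g) (delbar ξ.2)
  set B := β + delbar P.2 with hB
  have key := hasDerivAt_integral_of_continuous (μ := g.area)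
    (F := fun s => firstVariationDensity g β lam (P + s • ξ) η)
    (F' := fun s x => 2 * g.pairing (del ξ.1) (del η.1) x +
      (2 * η.1 x * (Real.exp (2 * (P.1 x + s * ξ.1 x)) *
        (2 * ξ.1 x * ((-lam / 2 + g.normSq B x) + 2 * s * g.pairing B (delbar ξ.2) x +
            s ^ 2 * g.normSq (delbar ξ.2) x) +
          2 * (g.pairing B (delbar ξ.2) x + s * g.normSq (delbar ξ.2) x))) +
        (Real.exp (2 * (P.1 x + s * ξ.1 x)) *
          (2 * ξ.1 x * (2 * g.pairing B (delbar η.2) x +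
            2 * s * g.pairing (delbar ξ.2) (delbar η.2) x + s ^ 2 * 0) +
          2 * (g.pairing (delbar ξ.2) (delbar η.2) x + s * 0)))))
    0 (fun t => continuous_firstVariationDensity _ _ _ _ _) (by fun_prop) ?_
  · refine key.congr_deriv ?_
    refine integral_congr_ae (Filter.Eventually.of_forall fun x => ?_)
    simp only [hessianDensity, zero_mul, mul_zero, add_zero, ← hB]
    ring_nf
  · intro s x
    have e1 := (hasDerivAt_exp_mul (a := P.1 x) (b := ξ.1 x) (c := -lam / 2 + g.normSq B x)
      (d := g.pairing B (delbar ξ.2) x) (e := g.normSq (delbar ξ.2) x) (t := s)).const_mul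
      (2 * η.1 x)
    -- The product ⟨β + ∂̄f, ∂̄η⟩ is affine along the line, hence the quadratic coefficient `e` is
    -- 0.
    have e2 := hasDerivAt_exp_mul (a := P.1 x) (b := ξ.1 x) (c := 2 * g.pairing B (delbar η.2) x)
      (d := g.pairing (delbar ξ.2) (delbar η.2) x) (e := 0) (t := s)
    have e3 : HasDerivAt (fun s : ℝ => 2 * (g.pairing (del P.1) (del η.1) x +
        s * g.pairing (del ξ.1) (del η.1) x) + g.gaussCurvature x * η.1 x)
        (2 * g.pairing (del ξ.1) (del η.1) x) s := by
      simpa using ((((hasDerivAt_id s).mul_const (g.pairing (del ξ.1) (del η.1) x)).const_add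
        (g.pairing (del P.1) (del η.1) x)).const_mul 2).add_const (g.gaussCurvature x * η.1 x)
    refine (e3.fun_add (e1.fun_add e2)).congr_of_eventuallyEq
      (Filter.Eventually.of_forall fun s => ?_)
    simp only [firstVariationDensity, del_line, delbar_line, normSq_add_smul, line_apply,
      pairing_add_left, pairing_smul_left, ← hB]
    ring

/-- The Hessian of the functional. -/
def hessian : LinearMap.BilinForm ℝ (SmoothFun X × VectorField X) :=
  have hi : ∀ ξ η : SmoothFun X × VectorField X,
      Integrable (hessianDensity g β lam P ξ η) g.area := fun ξ η =>
    g.integrable_area (continuous_hessianDensity g β lam P ξ η)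
  LinearMap.mk₂ ℝ (fun ξ η => ∫ x, hessianDensity g β lam P ξ η x ∂g.area)
    (fun ξ ξ' η => by
      rw [← integral_add (hi _ _) (hi _ _)]
      refine integral_congr_ae (Filter.Eventually.of_forall fun x => ?_)
      simp only [hessianDensity, Prod.fst_add, Prod.snd_add, del_add, delbar_add,
        pairing_add_left, pairing_add_right, ContMDiffMap.coe_add, Pi.add_apply]
      ring)
    (fun c ξ η => by
      rw [smul_eq_mul, ← integral_const_mul]
      refine integral_congr_ae (Filter.Eventually.of_forall fun x => ?_)
      simp only [hessianDensity, Prod.smul_fst, Prod.smul_snd, del_smul, delbar_smul,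
        pairing_smul_left, pairing_smul_right, ContMDiffMap.coe_smul, Pi.smul_apply, smul_eq_mul]
      ring)
    (fun ξ η η' => by
      rw [← integral_add (hi _ _) (hi _ _)]
      refine integral_congr_ae (Filter.Eventually.of_forall fun x => ?_)
      simp only [hessianDensity, Prod.fst_add, Prod.snd_add, del_add, delbar_add,
        pairing_add_left, pairing_add_right, ContMDiffMap.coe_add, Pi.add_apply]
      ring)
    (fun c ξ η => by
      rw [smul_eq_mul, ← integral_const_mul]
      refine integral_congr_ae (Filter.Eventually.of_forall fun x => ?_)
      simp only [hessianDensity, Prod.smul_fst, Prod.smul_snd, del_smul, delbar_smul,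
        pairing_smul_right, ContMDiffMap.coe_smul, Pi.smul_apply, smul_eq_mul]
      ring)

theorem hessian_apply :
    hessian g β lam P ξ η = ∫ x, hessianDensity g β lam P ξ η x ∂g.area := rfl

theorem isHessianAt_hessian :
    IsHessianAt (donaldson g β lam C) P (hessian g β lam P) where
  differentiable Q η := (hasDerivAt_donaldson g β lam C Q η).differentiableAt
  hasDerivAt ξ η := by
    have h : (fun s : ℝ => deriv (fun t : ℝ => donaldson g β lam C (P + s • ξ + t • η)) 0) =
        fun s => ∫ x, firstVariationDensity g β lam (P + s • ξ) η x ∂g.area :=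
      funext fun s => (hasDerivAt_donaldson g β lam C (P + s • ξ) η).deriv
    rw [h]
    exact hasDerivAt_firstVariation g β lam P ξ η
  symm := ⟨fun ξ η => by
    simp only [hessian_apply]
    refine integral_congr_ae (Filter.Eventually.of_forall fun x => ?_)
    simp only [hessianDensity, pairing_comm (del ξ.1), pairing_comm (delbar ξ.2)]
    ring⟩

/-! ### Positivity of the Hessian at a critical point -/

variable {g β lam C P}

theorem integral_firstVariationDensity_eq_zero
    (hP : IsCriticalPoint (donaldson g β lam C) P) :
    ∫ x, firstVariationDensity g β lam P η x ∂g.area = 0 :=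
  (hasDerivAt_donaldson g β lam C P η).unique (hP η)

omit [MeasurableSpace X] [BorelSpace X] [T2Space X] [CompactSpace X] in
-- Leibniz rule; since `v` is real, ∂̄v is the conjugate of ∂v.
theorem delbar_fsmul (v : SmoothFun X) (w : VectorField X) :
    delbar (fsmul v w) = fsmul v (delbar w) +
      tmul (p := 0) (q := 1) (by norm_num) (by norm_num) (tconj (del v)) w := by
  refine tensor_ext fun e z hz => ?_
  have h : (fsmul v (delbar w) + tmul (p := 0) (q := 1) (r := -1) (s := 1) (by norm_num)
      (by norm_num) (tconj (del v)) w).1 e z =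
      (v (e.1.symm z) : ℂ) * (delbar w).1 e z + conj ((del v).1 e z) * w.1 e z := rfl
  rw [h, delbar_apply _ hz, delbar_apply _ hz, del_apply _ hz, ← wirtingerBar_ofReal, add_comm]
  exact wirtingerBar_mul ((contDiffAt_chart v hz).differentiableAt (by simp))
    ((contDiffAt_tensor w hz).differentiableAt (by simp))

omit [IsManifold 𝓘(ℂ) ω X] [MeasurableSpace X] [BorelSpace X] [T2Space X] [CompactSpace X] in
theorem normSq_vectorField (w : VectorField X) (x : X) :
    g.normSq w x = g.density (chartIn x) (chartAt ℂ x x) / 2 *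
      ‖w.1 (chartIn x) (chartAt ℂ x x)‖ ^ 2 := by
  simp [ConformalMetric.normSq]

omit [MeasurableSpace X] [BorelSpace X] [T2Space X] [CompactSpace X] in
-- Cauchy–Schwarz followed by 2ab ≤ a² + b² with a = |∂v| and b = E|w||B|. The weight sits entirely
-- on b, so that a² is absorbed by the unweighted Dirichlet term of the Hessian.
theorem pairing_tmul_le (B : BeltramiForm X) (v : SmoothFun X) (w : VectorField X) (E : ℝ)
    (hE : 0 ≤ E) (x : X) :
    2 * E * g.pairing B (tmul (p := 0) (q := 1) (by norm_num) (by norm_num) (tconj (del v)) w) x ≤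
      g.normSq (del v) x + E ^ 2 * g.normSq w x * g.normSq B x := by
  have hρ := density_pos (g := g) x
  have h1 : g.pairing B (tmul (p := 0) (q := 1) (by norm_num) (by norm_num) (tconj (del v)) w) x =
      (conj (B.1 (chartIn x) (chartAt ℂ x x)) * (conj ((del v).1 (chartIn x) (chartAt ℂ x x)) *
        w.1 (chartIn x) (chartAt ℂ x x))).re := by
    simp [ConformalMetric.pairing, tmul, tconj]
  have h2 : g.normSq (del v) x = 2 / g.density (chartIn x) (chartAt ℂ x x) *
      ‖(del v).1 (chartIn x) (chartAt ℂ x x)‖ ^ 2 := by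
    simp [ConformalMetric.normSq]
  have h3 : g.normSq B x = ‖B.1 (chartIn x) (chartAt ℂ x x)‖ ^ 2 := by
    simp [ConformalMetric.normSq]
  rw [h1, h2, h3, normSq_vectorField]
  set ρ := g.density (chartIn x) (chartAt ℂ x x)
  set b := B.1 (chartIn x) (chartAt ℂ x x)
  set a := (del v).1 (chartIn x) (chartAt ℂ x x)
  set c := w.1 (chartIn x) (chartAt ℂ x x)
  have h4 : (conj b * (conj a * c)).re ≤ ‖b‖ * (‖a‖ * ‖c‖) := by
    refine (Complex.re_le_norm _).trans ?_
    simp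
  have h5 : 0 ≤ ρ / 2 * (2 / ρ * ‖a‖ - E * ‖c‖ * ‖b‖) ^ 2 := by positivity
  have h6 : ρ / 2 * (2 / ρ * ‖a‖ - E * ‖c‖ * ‖b‖) ^ 2 =
      2 / ρ * ‖a‖ ^ 2 + E ^ 2 * (ρ / 2 * ‖c‖ ^ 2) * ‖b‖ ^ 2 - 2 * E * (‖b‖ * (‖a‖ * ‖c‖)) := by
    field_simp
    ring
  have h7 := mul_le_mul_of_nonneg_left h4 (mul_nonneg zero_le_two hE)
  linarith

omit [IsManifold 𝓘(ℂ) ω X] [MeasurableSpace X] [BorelSpace X] [T2Space X] [CompactSpace X] in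
theorem pairing_fsmul_right [IsManifold 𝓘(ℂ) ω X] {p q : ℤ} (φ ψ : SmoothTensor X p q)
    (v : SmoothFun X) (x : X) : g.pairing φ (fsmul v ψ) x = v x * g.pairing φ ψ x := by
  have h : (fsmul v ψ).1 (chartIn x) (chartAt ℂ x x) =
      v x * ψ.1 (chartIn x) (chartAt ℂ x x) := by
    change (v ((chartAt ℂ x).symm (chartAt ℂ x x)) : ℂ) * _ = _
    rw [(chartAt ℂ x).left_inv (mem_chart_source ℂ x)]
  simp only [ConformalMetric.pairing, h, Complex.mul_re, Complex.mul_im, Complex.conj_re,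
    Complex.conj_im, Complex.ofReal_re, Complex.ofReal_im]
  ring

omit [MeasurableSpace X] [BorelSpace X] [T2Space X] [CompactSpace X] in
theorem exists_ne_zero_of_ne_zero (g : ConformalMetric X) (hξ : ξ ≠ 0) :
    ∃ x, ξ.1 x ≠ 0 ∨ g.normSq ξ.2 x ≠ 0 := by
  by_contra! h
  refine hξ (Prod.ext (ContMDiffMap.ext fun x => (h x).1) (tensor_ext fun e z hz => ?_))
  have h1 := (h (e.1.symm z)).2
  rw [g.normSq_symm_apply _ hz] at h1
  have := g.pos e z hz
  have h2 : ‖ξ.2.1 e z‖ ^ 2 = 0 := (mul_eq_zero.1 h1).resolve_left (by positivity)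
  simpa using h2

omit [MeasurableSpace X] [BorelSpace X] [T2Space X] [CompactSpace X] in
/-- The integrand of the Hessian, up to terms whose integral has a sign, is bounded below. -/
theorem hessianDensity_ge (x : X) :
    -2 * lam * Real.exp (2 * P.1 x) * ξ.1 x ^ 2 -
        lam * Real.exp (2 * P.1 x) * g.weightedNormSq P.1 ξ.2 x ≤
      hessianDensity g β lam P ξ ξ x -
        2 * firstVariationDensity g β lam P (0, fsmul ξ.1 ξ.2) x -
        ((Real.exp (2 * P.1 x) * g.normSq (delbar ξ.2) x +
          2 * g.pairing (del P.1) (del (g.weightedNormSq P.1 ξ.2)) x +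
            g.gaussCurvature x * g.weightedNormSq P.1 ξ.2 x) -
          firstVariationDensity g β lam P (g.weightedNormSq P.1 ξ.2, 0) x) := by
  obtain ⟨v, w⟩ := ξ
  set B := β + delbar P.2 with hB
  have hdel0 : del (0 : SmoothFun X) = 0 := by
    simpa using del_smul 0 (0 : SmoothFun X)
  have hdelbar0 : delbar (0 : VectorField X) = 0 := by
    simpa using delbar_smul 0 (0 : VectorField X)
  have hp0 : ∀ {p q : ℤ} (φ : SmoothTensor X p q), g.pairing φ 0 x = 0 := fun φ => by
    simpa using pairing_smul_right (g := g) φ 0 x 0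
  -- This square uses the 4v⟨B, ∂̄w⟩ left after subtracting the first variation along v w. It takes
  -- all of 4v²|B|² and one of the two copies of |∂̄w|²; the other copy goes to the Bochner term.
  have h1 : 0 ≤ g.normSq (delbar w + (2 * v x) • B) x := normSq_nonneg _ _
  rw [normSq_add_smul, pairing_comm] at h1
  have h2 := pairing_tmul_le (g := g) B v w (Real.exp (2 * P.1 x)) (Real.exp_pos _).le x
  have hw : g.weightedNormSq P.1 w x = Real.exp (2 * P.1 x) * g.normSq w x := rfl
  simp only [hessianDensity, firstVariationDensity, ← hB, hdel0, hdelbar0, hp0, delbar_fsmul,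
    pairing_add_right, pairing_fsmul_right, ContMDiffMap.coe_zero, Pi.zero_apply, pairing_self, hw]
  have h3 := mul_le_mul_of_nonneg_left h1 (Real.exp_pos (2 * P.1 x)).le
  generalize Real.exp (2 * P.1 x) = E at *
  linarith

/-- At a critical point the Hessian is positive definite. -/
theorem hessian_pos (hlam : lam < 0) (hP : IsCriticalPoint (donaldson g β lam C) P)
    (hξ : ξ ≠ 0) : 0 < hessian g β lam P ξ ξ := by
  have hE := P.1.contMDiff.continuous
  have hv := ξ.1.contMDiff.continuous
  have hw := (g.weightedNormSq P.1 ξ.2).contMDiff.continuous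
  have c0 : Continuous fun x => -2 * lam * Real.exp (2 * P.1 x) * ξ.1 x ^ 2 -
      lam * Real.exp (2 * P.1 x) * g.weightedNormSq P.1 ξ.2 x := by fun_prop
  have c1 := continuous_hessianDensity g β lam P ξ ξ
  have c2 := continuous_firstVariationDensity g β lam P (0, fsmul ξ.1 ξ.2)
  have c3 := continuous_firstVariationDensity g β lam P (g.weightedNormSq P.1 ξ.2, 0)
  have c4 : Continuous fun x => Real.exp (2 * P.1 x) * g.normSq (delbar ξ.2) x +
      2 * g.pairing (del P.1) (del (g.weightedNormSq P.1 ξ.2)) x +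
        g.gaussCurvature x * g.weightedNormSq P.1 ξ.2 x := by
    have h1 := continuous_normSq (g := g) (delbar ξ.2)
    have h2 := continuous_pairing (g := g) (del P.1) (del (g.weightedNormSq P.1 ξ.2))
    have h3 := continuous_gaussCurvature g
    fun_prop
  have i1 := g.integrable_area c1
  have i2 := (g.integrable_area c2).const_mul 2
  have i3 := g.integrable_area c3
  have i4 := g.integrable_area c4
  have hnonneg : ∀ x, 0 ≤ g.weightedNormSq P.1 ξ.2 x := fun x =>
    mul_nonneg (Real.exp_pos _).le (normSq_nonneg _ _)
  -- Both terms have the sign of -λ > 0, and they control `v` and `w` themselves rather than their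
  -- derivatives. Hence constant functions and holomorphic vector fields do not lie in the kernel.
  have hpos : 0 < ∫ x, (-2 * lam * Real.exp (2 * P.1 x) * ξ.1 x ^ 2 -
      lam * Real.exp (2 * P.1 x) * g.weightedNormSq P.1 ξ.2 x) ∂g.area := by
    have hterm : ∀ x, 0 ≤ -2 * lam * Real.exp (2 * P.1 x) * ξ.1 x ^ 2 ∧
        0 ≤ -lam * Real.exp (2 * P.1 x) * g.weightedNormSq P.1 ξ.2 x := fun x =>
      ⟨mul_nonneg (mul_nonneg (by linarith) (Real.exp_pos _).le) (sq_nonneg _),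
        mul_nonneg (mul_nonneg (by linarith) (Real.exp_pos _).le) (hnonneg x)⟩
    obtain ⟨x, hx⟩ := exists_ne_zero_of_ne_zero ξ g hξ
    refine c0.integral_pos_of_hasCompactSupport_nonneg_nonzero (x := x)
      (HasCompactSupport.of_compactSpace _) (fun y => ?_) (ne_of_gt ?_)
    · have := hterm y
      simp only [Pi.zero_apply]
      linarith
    · have hx0 := hterm x
      have hE0 := Real.exp_pos (2 * P.1 x)
      rcases hx with hx | hx
      · have : 0 < -2 * lam * Real.exp (2 * P.1 x) * ξ.1 x ^ 2 :=
          mul_pos (mul_pos (by linarith) hE0) (by positivity)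
        linarith
      · have h1 : 0 < g.normSq ξ.2 x := lt_of_le_of_ne (normSq_nonneg _ _) (Ne.symm hx)
        have : 0 < -lam * Real.exp (2 * P.1 x) * g.weightedNormSq P.1 ξ.2 x :=
          mul_pos (mul_pos (by linarith) hE0) (mul_pos hE0 h1)
        linarith
  have hle := integral_mono (g.integrable_area c0) ((i1.sub i2).sub (i4.sub i3))
    (hessianDensity_ge (g := g) (β := β) (lam := lam) (P := P) ξ)
  have hb := g.bochner_integral P.1 ξ.2
  -- The two first-variation integrals vanish by criticality, so only the Hessian and the
  -- nonnegative Bochner integral survive.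
  rw [integral_sub' (i1.sub i2) (i4.sub i3), integral_sub' i1 i2, integral_sub' i4 i3,
    integral_const_mul, integral_firstVariationDensity_eq_zero _ hP,
    integral_firstVariationDensity_eq_zero _ hP] at hle
  rw [hessian_apply]
  linarith

end Variation

end

end RiemannSurface

theorem mainTheorem2 {X : Type*} [TopologicalSpace X] [T2Space X] [CompactSpace X]
    [ChartedSpace ℂ X] [IsManifold 𝓘(ℂ) ω X] [MeasurableSpace X] [BorelSpace X]
    (g : RiemannSurface.ConformalMetric X) (β : RiemannSurface.BeltramiForm X)
    (lam C : ℝ) (hlam : lam < 0)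
    (P : RiemannSurface.SmoothFun X × RiemannSurface.VectorField X)
    (hP : IsCriticalPoint (RiemannSurface.donaldson g β lam C) P) :
    ∃ H : LinearMap.BilinForm ℝ (RiemannSurface.SmoothFun X × RiemannSurface.VectorField X),
      IsHessianAt (RiemannSurface.donaldson g β lam C) P H ∧
        ∀ ξ : RiemannSurface.SmoothFun X × RiemannSurface.VectorField X, ξ ≠ 0 → 0 < H ξ ξ :=
  ⟨RiemannSurface.hessian g β lam P, RiemannSurface.isHessianAt_hessian g β lam C P,
    fun ξ hξ => RiemannSurface.hessian_pos ξ hlam hP hξ⟩
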